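/- Let $p$ be a prime, $d\ge 1$ an integer, and $\psi:(\mathbb{Q}_p,+)\to\mathbb{C}_p^\times$ a non-trivial smooth character (i.e. with open kernel). Let $\mathcal{H}$ be the Heisenberg group, i.e. the set $\mathbb{Q}_p^d\times\mathbb{Q}_p^d\times\mathbb{Q}_p$ with multiplication $$[(x_1,y_1),t_1]\cdot[(x_2,y_2),t_2]=\Big[(x_1+x_2,\,y_1+y_2),\;t_1+t_2+\tfrac12\big(x_1\cdot y_2-y_1\cdot x_2\big)\Big],$$ and let $\rho_\psi$ be its Schrödinger representation on the $\mathbb{C}_p$-vector space $\mathcal{S}$ of locally constant, compactly supported functions $f:\mathbb{Q}_p^d\to\mathbb{C}_p$: $$(\rho_\psi([(u,v),t])f)(x)=\psi\big(t+\tfrac12 u\cdot v+v\cdot x\big)\,f(x+u).$$ The group $\mathrm{Sp}_{2d}(\mathbb{Q}_p)=\{g: gJg^t=J\}$, $J=\begin{pmatrix}0&I_d\\-I_d&0\end{pmatrix}$, acts on $\mathcal{H}$ on the right by $[w,t]\cdot g=[wg,t]$ ($w$ a row vector). An intertwining operator corresponding to $g\in \mathrm{Sp}_{2d}(\mathbb{Q}_p)$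 is an invertible $\mathbb{C}_p$-linear operator $T_g$ on $\mathcal{S}$ with $\rho_\psi(h)\circ T_g=T_g\circ\rho_\psi(h\cdot g)$ for all $h\in\mathcal{H}$. A norm on $\mathcal{S}$ is a function $\|\cdot\|:\mathcal{S}\to\mathbb{R}_{\ge0}$ that vanishes only at $0$ and satisfies $\|af\|=|a|_p\|f\|$ and $\|f_1+f_2\|\le\max(\|f_1\|,\|f_2\|)$. Two norms are equivalent if each is bounded by a positive constant times the other, and homothetic if one is a positive constant times the other. Let $\|f\|_{\sup}=\sup_{x}|f(x)|_p$. 1. Let $g=\begin{pmatrix}a&b\\c&d'\end{pmatrix}\in \mathrm{Sp}_{2d}(\mathbb{Q}_p)$ (with $d\times d$ blocks $a,b,c,d'$) and let $T_g$ be any intertwining operator corresponding to $g$. The norms $\|\cdot\|_{\sup}$ and $\|T_g(\cdot)\|_{\sup}$ are homothetic if and only if they are equivalent, if and only if $c=0$. 2. Every $g\in \mathrm{Sp}_{2d}(\mathbb{Q}_p)$ has a corresponding intertwining operator $T_g$, and $[\|\cdot\|]\cdot g=[\|T_g(\cdot)\|]$ (for any choice of $T_g$) is a well-defined right action of $\mathrm{Sp}_{2d}(\mathbb{Q}_p)$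 on the set of homothety classes of $\mathcal{H}$-invariant norms on $\mathcal{S}$. Let $P\subset \mathrm{Sp}_{2d}(\mathbb{Q}_p)$ be the subgroup of the matrices with $c=0$. Then $Pg\mapsto[\|\cdot\|_{\sup}]\cdot g=[\|T_g(\cdot)\|_{\sup}]$ is a well-defined bijection from $P\backslash \mathrm{Sp}_{2d}(\mathbb{Q}_p)$ onto the orbit of the homothety class of $\|\cdot\|_{\sup}$. -/

import Mathlib

open scoped Padic Matrix

noncomputable section

namespace HeisSchw

/-! ## Non-archimedean norms -/

/-- A (non-archimedean) norm on a vector space `V` over a normed field `K`. -/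
structure UltraNorm (K V : Type*) [NormedField K] [AddCommGroup V] [Module K V] where
  toFun : V → ℝ
  nonneg : ∀ v, 0 ≤ toFun v
  eq_zero_iff : ∀ v, toFun v = 0 ↔ v = 0
  smul_eq : ∀ (a : K) (v : V), toFun (a • v) = ‖a‖ * toFun v
  add_le_max : ∀ v w, toFun (v + w) ≤ max (toFun v) (toFun w)

namespace UltraNorm

variable {K V : Type*} [NormedField K] [AddCommGroup V] [Module K V]

instance : CoeFun (UltraNorm K V) (fun _ => V → ℝ) := ⟨toFun⟩

/-- `N₁` is dominated by `N₂`. -/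
def Dominated (N₁ N₂ : UltraNorm K V) : Prop :=
  ∃ D : ℝ, 0 < D ∧ ∀ v, N₁ v ≤ D * N₂ v

/-- Two norms are equivalent if each dominates the other. -/
def Equivalent (N₁ N₂ : UltraNorm K V) : Prop :=
  N₁.Dominated N₂ ∧ N₂.Dominated N₁

/-- Two norms are homothetic if one is a positive multiple of the other. -/
def Homothetic (N₁ N₂ : UltraNorm K V) : Prop :=
  ∃ c : ℝ, 0 < c ∧ ∀ v, N₁ v = c * N₂ v

theorem homothetic_equivalence : Equivalence (Homothetic (K := K) (V := V)) where
  refl N := ⟨1, one_pos, fun v => (one_mul _).symm⟩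
  symm := by
    rintro N₁ N₂ ⟨c, hc, h⟩
    refine ⟨c⁻¹, inv_pos.2 hc, fun v => ?_⟩
    rw [h v, inv_mul_cancel_left₀ hc.ne']
  trans := by
    rintro N₁ N₂ N₃ ⟨c, hc, h⟩ ⟨e, he, h'⟩
    exact ⟨c * e, mul_pos hc he, fun v => by rw [h v, h' v, mul_assoc]⟩

/-- The norm `v ↦ N (T v)` for an invertible linear operator `T`. -/
def pullback (N : UltraNorm K V) (T : V ≃ₗ[K] V) : UltraNorm K V where
  toFun v := N (T v)
  nonneg v := N.nonneg _
  eq_zero_iff v := by rw [N.eq_zero_iff]; exact T.map_eq_zero_iff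
  smul_eq a v := by rw [map_smul, N.smul_eq]
  add_le_max v w := by rw [map_add]; exact N.add_le_max _ _

end UltraNorm

/-- The norms on `V` that are invariant under a representation `ρ` of `G` on `V`. -/
def InvNorm {K V G : Type*} [NormedField K] [AddCommGroup V] [Module K V] [Group G]
    (ρ : Representation K G V) : Type _ :=
  {N : UltraNorm K V // ∀ (h : G) (v : V), N (ρ h v) = N v}

/-- Homothety as an equivalence relation on the invariant norms. -/
def invNormSetoid {K V G : Type*} [NormedField K] [AddCommGroup V] [Module K V] [Group G]
    (ρ : Representation K G V) : Setoid (InvNorm ρ) where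
  r N₁ N₂ := N₁.1.Homothetic N₂.1
  iseqv :=
    ⟨fun _ => UltraNorm.homothetic_equivalence.refl _,
      fun h => UltraNorm.homothetic_equivalence.symm h,
      fun h h' => UltraNorm.homothetic_equivalence.trans h h'⟩

/-- The set of homothety classes of invariant norms. -/
def InvNormClass {K V G : Type*} [NormedField K] [AddCommGroup V] [Module K V] [Group G]
    (ρ : Representation K G V) : Type _ :=
  Quotient (invNormSetoid ρ)

/-- The homothety class of an invariant norm. -/
def InvNorm.toClass {K V G : Type*} [NormedField K] [AddCommGroup V] [Module K V] [Group G]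
    {ρ : Representation K G V} (N : InvNorm ρ) : InvNormClass ρ :=
  Quotient.mk (invNormSetoid ρ) N

/-! ## The Heisenberg group -/

/-- The Heisenberg group of dimension `2d+1` over `ℚ_[p]`, with elements `[(x, y), t]`. -/
@[ext]
structure Heis (p : ℕ) [Fact p.Prime] (d : ℕ) where
  x : Fin d → ℚ_[p]
  y : Fin d → ℚ_[p]
  t : ℚ_[p]

namespace Heis

variable {p : ℕ} [Fact p.Prime] {d : ℕ}

/-- `[w₁, t₁] * [w₂, t₂] = [w₁ + w₂, t₁ + t₂ + ω(w₁, w₂) / 2]` with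
`ω((x₁, y₁), (x₂, y₂)) = x₁ ⬝ᵥ y₂ - y₁ ⬝ᵥ x₂`. -/
instance : Mul (Heis p d) where
  mul h k := ⟨h.x + k.x, h.y + k.y, h.t + k.t + 1 / 2 * (h.x ⬝ᵥ k.y - h.y ⬝ᵥ k.x)⟩

instance : One (Heis p d) where
  one := ⟨0, 0, 0⟩

instance : Inv (Heis p d) where
  inv h := ⟨-h.x, -h.y, -h.t⟩

@[simp] theorem mul_x (h k : Heis p d) : (h * k).x = h.x + k.x := rfl
@[simp] theorem mul_y (h k : Heis p d) : (h * k).y = h.y + k.y := rfl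
@[simp] theorem mul_t (h k : Heis p d) :
    (h * k).t = h.t + k.t + 1 / 2 * (h.x ⬝ᵥ k.y - h.y ⬝ᵥ k.x) := rfl
@[simp] theorem one_x : (1 : Heis p d).x = 0 := rfl
@[simp] theorem one_y : (1 : Heis p d).y = 0 := rfl
@[simp] theorem one_t : (1 : Heis p d).t = 0 := rfl
@[simp] theorem inv_x (h : Heis p d) : (h⁻¹).x = -h.x := rfl
@[simp] theorem inv_y (h : Heis p d) : (h⁻¹).y = -h.y := rfl
@[simp] theorem inv_t (h : Heis p d) : (h⁻¹).t = -h.t := rfl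

instance : Group (Heis p d) :=
  Group.ofLeftAxioms
    (by
      intro a b c
      ext1
      · simp [add_assoc]
      · simp [add_assoc]
      · simp only [mul_x, mul_y, mul_t, add_dotProduct, dotProduct_add]
        ring)
    (by
      intro a
      ext1 <;> simp)
    (by
      intro a
      ext1
      · simp
      · simp
      · simp [dotProduct_comm])

/-- The right action `[w, t] · g = [w g, t]` of a `2d × 2d` matrix `g`, where `w = (x, y)` is a
row vector. -/
def act (h : Heis p d) (g : Matrix (Fin d ⊕ Fin d) (Fin d ⊕ Fin d) ℚ_[p]) : Heis p d where
  x := h.x ᵥ* g.toBlocks₁₁ + h.y ᵥ* g.toBlocks₂₁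
  y := h.x ᵥ* g.toBlocks₁₂ + h.y ᵥ* g.toBlocks₂₂
  t := h.t

theorem act_act (h : Heis p d) (g g' : Matrix (Fin d ⊕ Fin d) (Fin d ⊕ Fin d) ℚ_[p]) :
    (h.act g).act g' = h.act (g * g') := by
  obtain ⟨a, b, c, e, rfl⟩ : ∃ a b c e, g = Matrix.fromBlocks a b c e :=
    ⟨_, _, _, _, (Matrix.fromBlocks_toBlocks g).symm⟩
  obtain ⟨a', b', c', e', rfl⟩ : ∃ a b c e, g' = Matrix.fromBlocks a b c e :=
    ⟨_, _, _, _, (Matrix.fromBlocks_toBlocks g').symm⟩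
  rw [Matrix.fromBlocks_multiply]
  ext1
  · simp only [act, Matrix.toBlocks_fromBlocks₁₁, Matrix.toBlocks_fromBlocks₁₂,
      Matrix.toBlocks_fromBlocks₂₁, Matrix.toBlocks_fromBlocks₂₂, Matrix.add_vecMul,
      Matrix.vecMul_add, Matrix.vecMul_vecMul]
    abel
  · simp only [act, Matrix.toBlocks_fromBlocks₁₁, Matrix.toBlocks_fromBlocks₁₂,
      Matrix.toBlocks_fromBlocks₂₁, Matrix.toBlocks_fromBlocks₂₂, Matrix.add_vecMul,
      Matrix.vecMul_add, Matrix.vecMul_vecMul]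
    abel
  · rfl

theorem act_one (h : Heis p d) : h.act 1 = h := by
  ext1
  · simp only [act]
    rw [← Matrix.fromBlocks_one]
    simp only [Matrix.toBlocks_fromBlocks₁₁, Matrix.toBlocks_fromBlocks₂₁,
      Matrix.vecMul_one, Matrix.vecMul_zero, add_zero]
  · simp only [act]
    rw [← Matrix.fromBlocks_one]
    simp only [Matrix.toBlocks_fromBlocks₁₂, Matrix.toBlocks_fromBlocks₂₂,
      Matrix.vecMul_one, Matrix.vecMul_zero, zero_add]
  · rfl

end Heis

/-! ## Schwartz functions and the Schrödinger representation -/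

/-- The space of locally constant, compactly supported functions `ℚ_[p]^d → ℂ_[p]`. -/
def Schw (p : ℕ) [Fact p.Prime] (d : ℕ) : Submodule ℂ_[p] ((Fin d → ℚ_[p]) → ℂ_[p]) where
  carrier := {f | IsLocallyConstant f ∧ HasCompactSupport f}
  add_mem' := fun hf hg => ⟨hf.1.add hg.1, hf.2.add hg.2⟩
  zero_mem' := ⟨IsLocallyConstant.const 0, HasCompactSupport.zero⟩
  smul_mem' := fun c _ hf =>
    ⟨hf.1.comp (fun z => c * z), HasCompactSupport.mul_left (f := fun _ => c) hf.2⟩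

/-- A character of `(ℚ_[p], +)` is smooth if its kernel is open. -/
def IsSmoothChar {p : ℕ} [Fact p.Prime] (ψ : AddChar ℚ_[p] ℂ_[p]) : Prop :=
  IsOpen {t : ℚ_[p] | ψ t = 1}

theorem IsSmoothChar.isLocallyConstant {p : ℕ} [Fact p.Prime] {ψ : AddChar ℚ_[p] ℂ_[p]}
    (hψ : IsSmoothChar ψ) : IsLocallyConstant ψ := by
  rw [IsLocallyConstant.iff_exists_open]
  intro s
  refine ⟨(fun u => u - s) ⁻¹' {t | ψ t = 1}, hψ.preimage (by fun_prop), by simp, ?_⟩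
  intro u hu
  have h1 : ψ (u - s) = 1 := hu
  calc ψ u = ψ (u - s + s) := by rw [sub_add_cancel]
    _ = ψ s := by rw [AddChar.map_add_eq_mul, h1, one_mul]

section Schrodinger

variable {p : ℕ} [Fact p.Prime] {d : ℕ} {ψ : AddChar ℚ_[p] ℂ_[p]}

/-- The function `x ↦ ψ(t + (a ⬝ᵥ b) / 2 + b ⬝ᵥ x) f(x + a)` for `h = [(a, b), t]`. -/
def schrodingerFun (hψ : IsSmoothChar ψ) (h : Heis p d) (f : Schw p d) : Schw p d :=
  ⟨fun x => ψ (h.t + 1 / 2 * (h.x ⬝ᵥ h.y) + h.y ⬝ᵥ x) * f.1 (x + h.x), by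
    refine ⟨IsLocallyConstant.mul ?_ ?_, HasCompactSupport.mul_left ?_⟩
    · exact hψ.isLocallyConstant.comp_continuous
        (f := fun x : Fin d → ℚ_[p] => h.t + 1 / 2 * (h.x ⬝ᵥ h.y) + h.y ⬝ᵥ x)
        (by unfold dotProduct; fun_prop)
    · exact f.2.1.comp_continuous (f := fun x : Fin d → ℚ_[p] => x + h.x) (by fun_prop)
    · exact f.2.2.comp_homeomorph (Homeomorph.addRight h.x)⟩

/-- The Schrödinger representation of the Heisenberg group with central character `ψ`:
`(ρ([(a, b), t]) f)(x) = ψ(t + (a ⬝ᵥ b) / 2 + b ⬝ᵥ x) f(x + a)`. -/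
def schrodinger (d : ℕ) (hψ : IsSmoothChar ψ) : Representation ℂ_[p] (Heis p d) (Schw p d) where
  toFun h :=
    { toFun := schrodingerFun hψ h
      map_add' := fun f₁ f₂ => Subtype.ext (funext fun x => by simp [schrodingerFun, mul_add])
      map_smul' := fun c f => Subtype.ext (funext fun x => by
        simp [schrodingerFun, mul_left_comm]) }
  map_one' := by
    ext f x
    simp [schrodingerFun]
  map_mul' h k := by
    ext f x
    simp only [schrodingerFun, Heis.mul_x, Heis.mul_y, Heis.mul_t, LinearMap.coe_mk,
      AddHom.coe_mk, Module.End.mul_apply]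
    rw [← mul_assoc, ← AddChar.map_add_eq_mul, add_assoc x]
    congr 2
    simp only [add_dotProduct, dotProduct_add]
    rw [dotProduct_comm k.x h.y, dotProduct_comm h.x k.y]
    ring

/-- An invertible operator `T` on the Schwartz space is an intertwining operator corresponding to
`g` if `ρ(h) ∘ T = T ∘ ρ(h · g)` for every `h` in the Heisenberg group. -/
def IsIntertwiner (hψ : IsSmoothChar ψ) (g : Matrix.symplecticGroup (Fin d) ℚ_[p])
    (T : Schw p d ≃ₗ[ℂ_[p]] Schw p d) : Prop :=
  ∀ (h : Heis p d) (f : Schw p d),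
    schrodinger d hψ h (T f) = T (schrodinger d hψ (h.act g.1) f)

/-- If `N` is an invariant norm and `T` an intertwining operator, then `f ↦ N (T f)` is an
invariant norm. -/
def InvNorm.pullback {hψ : IsSmoothChar ψ} (N : InvNorm (schrodinger d hψ))
    {g : Matrix.symplecticGroup (Fin d) ℚ_[p]} {T : Schw p d ≃ₗ[ℂ_[p]] Schw p d}
    (hT : IsIntertwiner hψ g T) : InvNorm (schrodinger d hψ) :=
  ⟨N.1.pullback T, fun h f => by
    have h1 : (h.act (g⁻¹).1).act g.1 = h := by
      rw [Heis.act_act, ← Submonoid.coe_mul, inv_mul_cancel, Submonoid.coe_one, Heis.act_one]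
    have h2 := hT (h.act (g⁻¹).1) f
    rw [h1] at h2
    change N.1 (T (schrodinger d hψ h f)) = N.1 (T f)
    rw [← h2]
    exact N.2 _ _⟩

end Schrodinger

/-! ## The sup norm -/

section SupNorm

variable {p : ℕ} [Fact p.Prime] {d : ℕ} {ψ : AddChar ℚ_[p] ℂ_[p]}

theorem Schw.bddAbove (f : Schw p d) : BddAbove (Set.range fun x => ‖f.1 x‖) := by
  obtain ⟨C, hC⟩ := f.2.2.exists_bound_of_continuous f.2.1.continuous
  exact ⟨C, by rintro _ ⟨x, rfl⟩; exact hC x⟩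

theorem Schw.norm_le_iSup (f : Schw p d) (x : Fin d → ℚ_[p]) : ‖f.1 x‖ ≤ ⨆ x, ‖f.1 x‖ :=
  le_ciSup (Schw.bddAbove f) x

/-- The sup norm on the Schwartz space. -/
def supNorm (p : ℕ) [Fact p.Prime] (d : ℕ) : UltraNorm ℂ_[p] (Schw p d) where
  toFun f := ⨆ x, ‖f.1 x‖
  nonneg f := Real.iSup_nonneg fun x => norm_nonneg _
  eq_zero_iff f := by
    constructor
    · intro h
      refine Subtype.ext (funext fun x => ?_)
      have h1 := Schw.norm_le_iSup f x
      rw [h] at h1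
      exact norm_le_zero_iff.1 h1
    · rintro rfl
      simp
  smul_eq a f := by
    rw [Real.mul_iSup_of_nonneg (norm_nonneg a)]
    simp
  add_le_max f₁ f₂ := by
    refine ciSup_le fun x => ?_
    refine (IsUltrametricDist.norm_add_le_max (f₁.1 x) (f₂.1 x)).trans ?_
    exact max_le_max (Schw.norm_le_iSup f₁ x) (Schw.norm_le_iSup f₂ x)

theorem IsSmoothChar.norm_eq_one (hψ : IsSmoothChar ψ) (s : ℚ_[p]) : ‖ψ s‖ = 1 := by
  have hlim : Filter.Tendsto (fun n : ℕ => (p : ℚ_[p]) ^ n * s) Filter.atTop (nhds 0) := by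
    have h1 : Filter.Tendsto (fun n : ℕ => (p : ℚ_[p]) ^ n) Filter.atTop (nhds 0) :=
      tendsto_pow_atTop_nhds_zero_of_norm_lt_one Padic.norm_p_lt_one
    simpa using h1.mul_const s
  have hmem : {t : ℚ_[p] | ψ t = 1} ∈ nhds (0 : ℚ_[p]) :=
    hψ.mem_nhds (by simp)
  obtain ⟨n, hn⟩ := (hlim.eventually hmem).exists
  have h2 : ψ s ^ (p ^ n) = 1 := by
    rw [← AddChar.map_nsmul_eq_pow]
    simpa [nsmul_eq_mul] using hn
  have h3 : ‖ψ s‖ ^ (p ^ n) = 1 := by rw [← norm_pow, h2, norm_one]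
  exact (pow_eq_one_iff_of_nonneg (norm_nonneg _)
    (pow_ne_zero _ (Fact.out : p.Prime).ne_zero)).1 h3

/-- The sup norm as an invariant norm on the Schrödinger representation. -/
def supInvNorm (d : ℕ) (hψ : IsSmoothChar ψ) : InvNorm (schrodinger d hψ) :=
  ⟨supNorm p d, fun h f => by
    change ⨆ x, ‖ψ (h.t + 1 / 2 * (h.x ⬝ᵥ h.y) + h.y ⬝ᵥ x) * f.1 (x + h.x)‖ = ⨆ x, ‖f.1 x‖
    simp only [norm_mul, hψ.norm_eq_one, one_mul]
    exact (Equiv.addRight h.x).iSup_congr fun x => rfl⟩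

end SupNorm

/-! ## The Siegel parabolic subgroup -/

/-- The symplectic matrices whose lower left `d × d` block vanishes. -/
def siegelParabolic (p : ℕ) [Fact p.Prime] (d : ℕ) :
    Subgroup (Matrix.symplecticGroup (Fin d) ℚ_[p]) where
  carrier := {g | g.1.toBlocks₂₁ = 0}
  one_mem' := by
    change Matrix.toBlocks₂₁ (1 : Matrix (Fin d ⊕ Fin d) (Fin d ⊕ Fin d) ℚ_[p]) = 0
    rw [← Matrix.fromBlocks_one, Matrix.toBlocks_fromBlocks₂₁]
  mul_mem' := by
    intro g h hg hh
    change g.1.toBlocks₂₁ = 0 at hg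
    change h.1.toBlocks₂₁ = 0 at hh
    change (g.1 * h.1).toBlocks₂₁ = 0
    rw [← Matrix.fromBlocks_toBlocks g.1, ← Matrix.fromBlocks_toBlocks h.1,
      Matrix.fromBlocks_multiply, Matrix.toBlocks_fromBlocks₂₁, hg, hh]
    simp
  inv_mem' := by
    intro g hg
    change g.1.toBlocks₂₁ = 0 at hg
    change (g⁻¹).1.toBlocks₂₁ = 0
    rw [SymplecticGroup.coe_inv, ← Matrix.fromBlocks_toBlocks g.1, Matrix.J,
      Matrix.fromBlocks_transpose, Matrix.fromBlocks_neg, Matrix.fromBlocks_multiply,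
      Matrix.fromBlocks_multiply, Matrix.toBlocks_fromBlocks₂₁, hg]
    simp

/-- The space `P \ Sp_{2d}(ℚ_[p])` of right cosets `P g`. -/
def SiegelCosets (p : ℕ) [Fact p.Prime] (d : ℕ) : Type :=
  Quotient (QuotientGroup.rightRel (siegelParabolic p d))

/-- The right coset `P g`. -/
def SiegelCosets.mk {p : ℕ} [Fact p.Prime] {d : ℕ}
    (g : Matrix.symplecticGroup (Fin d) ℚ_[p]) : SiegelCosets p d :=
  Quotient.mk (QuotientGroup.rightRel (siegelParabolic p d)) g

end HeisSchw

end

namespace HeisSchw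

variable {p : ℕ} [Fact p.Prime] {d : ℕ} {ψ : AddChar ℚ_[p] ℂ_[p]}

/-! ## Schwartz functions -/

/-! Schur's lemma (`exists_eq_smul_of_commute`) holds by pure algebra. An operator commuting with
all modulations cannot enlarge supports, so its value at `x` depends only on `f x`; commuting with
translations then makes it a scalar. Hence two intertwiners for the same `g` are proportional, `[N ∘
T_g]` depends only on `g`, and composing intertwiners gives a right action.

Existence of intertwiners: for `c = 0` an explicit operator `f ↦ ψ(q x) f(x a)` works, and it
preserves the sup norm because `ψ` has absolute value 1. For `J` the Fourier transform works; it
uses a `ℂ_[p]`-valued translation invariant integral, and Schur's lemma gives its inversion formula.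
An arbitrary `g` is moved into the parabolic by an upper unipotent matrix followed by a
`J`-conjugate of another one (`exists_symm_isUnit_add_mul`, `exists_isIntertwiner`).

Inequivalence for `c ≠ 0` (`IsIntertwiner.toBlocks₂₁_eq_zero`): choose `v` with `w = v c ≠ 0`. The
inverse of `T` turns modulation by multiples of `v` into translation by multiples of `w`, up to a
character. Summing `p ^ m` suitable modulations of a well chosen `f` multiplies `f` pointwise by 0
or `p ^ m`, so the sup norm shrinks by at least `p ^ (-m)`. On the other side the translates have
disjoint supports, so the sum keeps the values of `T⁻¹ f` on its support. Letting `m` grow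
contradicts domination. The stabilizer of the class of the sup norm is therefore the Siegel
parabolic, and the bijection is orbit-stabilizer. -/

theorem Schw.exists_bound_support (f : Schw p d) :
    ∃ R : ℝ, 0 < R ∧ ∀ x, R < ‖x‖ → f.1 x = 0 := by
  obtain ⟨R, hR⟩ := f.2.2.isCompact.isBounded.exists_norm_le
  refine ⟨max R 1, by positivity, fun x hx => ?_⟩
  by_contra h
  exact absurd (hR x (subset_tsupport _ h)) (not_le.2 ((le_max_left _ _).trans_lt hx))

theorem norm_add_eq_left_of_lt {x y : Fin d → ℚ_[p]} (h : ‖y‖ < ‖x‖) : ‖x + y‖ = ‖x‖ := by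
  rw [IsUltrametricDist.norm_add_eq_max_of_norm_ne_norm h.ne', max_eq_left h.le]

/-- Local constancy is uniform by compactness on a ball containing the support. Outside that ball a
short translation does not change the norm, so both values vanish. -/
theorem Schw.exists_invariant (f : Schw p d) :
    ∃ δ : ℝ, 0 < δ ∧ ∀ x y, ‖y‖ ≤ δ → f.1 (x + y) = f.1 x := by
  obtain ⟨R, hR, hf⟩ := Schw.exists_bound_support f
  have key : ∀ᶠ y in nhds (0 : Fin d → ℚ_[p]), ∀ x ∈ Metric.closedBall (0 : Fin d → ℚ_[p]) R,
      f.1 (x + y) = f.1 x := by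
    refine (isCompact_closedBall (0 : Fin d → ℚ_[p]) R).eventually_forall_of_forall_eventually
      (P := fun y x => f.1 (x + y) = f.1 x) fun x _ => ?_
    have h1 : ∀ᶠ z : (Fin d → ℚ_[p]) × (Fin d → ℚ_[p]) in nhds (0, x), f.1 (z.2 + z.1) = f.1 x := by
      have hc : Filter.Tendsto (fun z : (Fin d → ℚ_[p]) × (Fin d → ℚ_[p]) => z.2 + z.1)
          (nhds (0, x)) (nhds x) := by
        have : Continuous (fun z : (Fin d → ℚ_[p]) × (Fin d → ℚ_[p]) => z.2 + z.1) := by fun_prop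
        simpa using this.tendsto (0, x)
      exact hc.eventually (f.2.1.eventually_eq x)
    have h2 : ∀ᶠ z : (Fin d → ℚ_[p]) × (Fin d → ℚ_[p]) in nhds (0, x), f.1 z.2 = f.1 x :=
      (continuous_snd.tendsto ((0 : Fin d → ℚ_[p]), x)).eventually (f.2.1.eventually_eq x)
    filter_upwards [h1, h2] with z hz1 hz2
    rw [hz1, hz2]
  obtain ⟨ε, hε, h⟩ := Metric.eventually_nhds_iff.1 key
  -- `ε / 2` turns the open condition into a closed one; the bound by `R` keeps `x + y` outside the
  -- ball whenever `x` is outside.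
  refine ⟨min (ε / 2) R, by positivity, fun x y hy => ?_⟩
  by_cases hx : ‖x‖ ≤ R
  · refine h ?_ x (by simpa using hx)
    rw [dist_zero_right]
    have := hy.trans (min_le_left _ _)
    linarith
  · push Not at hx
    have hy' : ‖y‖ < ‖x‖ := (hy.trans (min_le_right _ _)).trans_lt hx
    rw [hf x hx, hf]
    rwa [norm_add_eq_left_of_lt hy']

open Classical in
/-- The indicator function of the closed ball of radius `r` around `0`. -/
noncomputable def Schw.ball (p : ℕ) [Fact p.Prime] (d : ℕ) {r : ℝ} (hr : 0 < r) : Schw p d :=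
  ⟨fun x => if ‖x‖ ≤ r then 1 else 0, by
    have hcl : IsClopen (Metric.closedBall (0 : Fin d → ℚ_[p]) r) :=
      IsUltrametricDist.isClopen_closedBall 0 hr.ne'
    constructor
    · rw [IsLocallyConstant.iff_exists_open]
      intro x
      by_cases hx : ‖x‖ ≤ r
      · refine ⟨_, hcl.isOpen, by simpa using hx, fun y hy => ?_⟩
        rw [mem_closedBall_zero_iff] at hy
        simp [hx, hy]
      · refine ⟨_, hcl.compl.isOpen, by simpa using hx, fun y hy => ?_⟩
        rw [Set.mem_compl_iff, mem_closedBall_zero_iff] at hy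
        simp [hx, hy]
    · refine HasCompactSupport.intro (isCompact_closedBall (0 : Fin d → ℚ_[p]) r) fun x hx => ?_
      rw [mem_closedBall_zero_iff] at hx
      simp [hx]⟩

theorem Schw.ball_of_le {r : ℝ} (hr : 0 < r) {x : Fin d → ℚ_[p]} (hx : ‖x‖ ≤ r) :
    (Schw.ball p d hr).1 x = 1 := if_pos hx

theorem Schw.ball_of_lt {r : ℝ} (hr : 0 < r) {x : Fin d → ℚ_[p]} (hx : r < ‖x‖) :
    (Schw.ball p d hr).1 x = 0 := if_neg (not_le.2 hx)

theorem schrodinger_apply (hψ : IsSmoothChar ψ) (h : Heis p d)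
    (f : Schw p d) (x : Fin d → ℚ_[p]) :
    (schrodinger d hψ h f).1 x =
      ψ (h.t + 1 / 2 * (h.x ⬝ᵥ h.y) + h.y ⬝ᵥ x) * f.1 (x + h.x) := rfl

/-! ## Schur's lemma -/

theorem exists_apply_ne_one (hψ1 : ψ ≠ 1) : ∃ t, ψ t ≠ 1 := by
  by_contra! h
  exact hψ1 (DFunLike.ext _ _ fun t => by simpa using h t)

theorem exists_char_dotProduct_ne (hψ1 : ψ ≠ 1) {x y : Fin d → ℚ_[p]} (hxy : x ≠ y) :
    ∃ v : Fin d → ℚ_[p], ψ (v ⬝ᵥ x) ≠ ψ (v ⬝ᵥ y) := by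
  obtain ⟨i, hi⟩ := Function.ne_iff.1 hxy
  obtain ⟨t, ht⟩ := exists_apply_ne_one hψ1
  -- Scaled so that `v ⬝ᵥ (x - y) = t`, where `ψ t ≠ 1`.
  refine ⟨Pi.single i (t / (x i - y i)), fun h => ht ?_⟩
  have h3 : Pi.single i (t / (x i - y i)) ⬝ᵥ x = t + Pi.single i (t / (x i - y i)) ⬝ᵥ y := by
    have := sub_ne_zero.2 hi
    rw [single_dotProduct, single_dotProduct]
    field_simp
    ring
  have h2 : ψ (Pi.single i (t / (x i - y i)) ⬝ᵥ y) ≠ 0 := by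
    intro h0
    have := ψ.map_add_eq_mul (Pi.single i (t / (x i - y i)) ⬝ᵥ y)
      (-(Pi.single i (t / (x i - y i)) ⬝ᵥ y))
    rw [h0, add_neg_cancel, AddChar.map_zero_eq_one, zero_mul] at this
    exact one_ne_zero this
  rw [h3, ψ.map_add_eq_mul] at h
  exact mul_right_cancel₀ h2 (by rw [h, one_mul])

/-- An operator commuting with the Schrödinger representation does not enlarge supports. -/
theorem apply_eq_zero_of_commute (hψ : IsSmoothChar ψ) (hψ1 : ψ ≠ 1)
    (T : Schw p d →ₗ[ℂ_[p]] Schw p d)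
    (hT : ∀ h f, schrodinger d hψ h (T f) = T (schrodinger d hψ h f))
    (f : Schw p d) {x : Fin d → ℚ_[p]} (hx : f.1 x = 0) : (T f).1 x = 0 := by
  -- `P K` says that some multiplier `φ`, commuting with `T`, vanishes on `K` but not at `x`.
  -- Multipliers are multiplied to pass to unions, so compactness reduces the support of `f` to
  -- neighbourhoods of single points.
  let P : Set (Fin d → ℚ_[p]) → Prop := fun K => ∃ φ : (Fin d → ℚ_[p]) → ℂ_[p],
    (∀ f : Schw p d, ∃ f' : Schw p d, (∀ y, f'.1 y = φ y * f.1 y) ∧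
      ∀ y, (T f').1 y = φ y * (T f).1 y) ∧ (∀ y ∈ K, φ y = 0) ∧ φ x ≠ 0
  have hsupp : IsClosed (Function.support f.1) :=
    ⟨f.2.1 ({0}ᶜ)ᶜ⟩
  have hcpt : IsCompact (Function.support f.1) := by
    have := f.2.2.isCompact
    rwa [tsupport, hsupp.closure_eq] at this
  have hP : P (Function.support f.1) := by
    refine hcpt.induction_on (p := P) ?_ ?_ ?_ ?_
    · exact ⟨fun _ => 1, fun f => ⟨f, by simp⟩, by simp, one_ne_zero⟩
    · rintro s t hst ⟨φ, h1, h2, h3⟩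
      exact ⟨φ, h1, fun y hy => h2 y (hst hy), h3⟩
    · rintro s t ⟨φ, h1, h2, h3⟩ ⟨φ', h1', h2', h3'⟩
      refine ⟨fun y => φ y * φ' y, fun f => ?_, ?_, mul_ne_zero h3 h3'⟩
      · obtain ⟨f', hf', hTf'⟩ := h1' f
        obtain ⟨f'', hf'', hTf''⟩ := h1 f'
        exact ⟨f'', fun y => by rw [hf'', hf', mul_assoc], fun y => by rw [hTf'', hTf', mul_assoc]⟩
      · rintro y (hy | hy)
        · simp [h2 y hy]
        · simp [h2' y hy]
    · intro y hy
      have hxy : x ≠ y := by rintro rfl; exact hy hx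
      -- The local multiplier is `ψ(v ⬝ᵥ z) - ψ(v ⬝ᵥ y)`: a modulation minus a scalar, zero near `y`
      -- by local constancy.
      obtain ⟨v, hv⟩ := exists_char_dotProduct_ne hψ1 hxy
      have hlc : IsLocallyConstant fun z : Fin d → ℚ_[p] => ψ (v ⬝ᵥ z) :=
        hψ.isLocallyConstant.comp_continuous (f := fun z : Fin d → ℚ_[p] => v ⬝ᵥ z)
          (by unfold dotProduct; fun_prop)
      refine ⟨{z | ψ (v ⬝ᵥ z) = ψ (v ⬝ᵥ y)},
        mem_nhdsWithin_of_mem_nhds (hlc.eventually_eq y),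
        fun z => ψ (v ⬝ᵥ z) - ψ (v ⬝ᵥ y), fun f => ?_, fun z hz => sub_eq_zero.2 hz,
        sub_ne_zero.2 hv⟩
      have hmul : ∀ (f : Schw p d) z, (schrodinger d hψ ⟨0, v, 0⟩ f).1 z = ψ (v ⬝ᵥ z) * f.1 z :=
        fun f z => by simp [schrodinger_apply]
      refine ⟨schrodinger d hψ ⟨0, v, 0⟩ f - ψ (v ⬝ᵥ y) • f, fun z => ?_, fun z => ?_⟩
      · change (schrodinger d hψ ⟨0, v, 0⟩ f).1 z - ψ (v ⬝ᵥ y) * f.1 z = _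
        rw [hmul, sub_mul]
      · rw [map_sub, map_smul, ← hT]
        change (schrodinger d hψ ⟨0, v, 0⟩ (T f)).1 z - ψ (v ⬝ᵥ y) * (T f).1 z = _
        rw [hmul, sub_mul]
  obtain ⟨φ, h1, h2, h3⟩ := hP
  obtain ⟨f', hf', hTf'⟩ := h1 f
  -- `φ` kills the whole support of `f`, so `φ f = 0` and hence `φ · T f = 0`, while `φ x ≠ 0`.
  have h0 : f' = 0 := Subtype.ext (funext fun y => by
    rw [hf']
    by_cases hy : f.1 y = 0
    · simp [hy]
    · simp [h2 y hy])
  have h4 := hTf' x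
  rw [h0, map_zero] at h4
  exact (mul_eq_zero.1 h4.symm).resolve_left h3

/-- Schur's lemma for the Schrödinger representation. -/
theorem exists_eq_smul_of_commute (hψ : IsSmoothChar ψ) (hψ1 : ψ ≠ 1)
    (T : Schw p d →ₗ[ℂ_[p]] Schw p d)
    (hT : ∀ h f, schrodinger d hψ h (T f) = T (schrodinger d hψ h f)) :
    ∃ c : ℂ_[p], ∀ f, T f = c • f := by
  let e : Schw p d := Schw.ball p d one_pos
  refine ⟨(T e).1 0, fun f => Subtype.ext (funext fun x => ?_)⟩
  have hρ : ∀ (f : Schw p d), (schrodinger d hψ ⟨-x, 0, 0⟩ f).1 x = f.1 0 := fun f => by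
    simp [schrodinger_apply]
  -- Subtracting a multiple of the translate of `e` centred at `x` kills the value at `x`; the
  -- support lemma then computes `T f` at `x` from `T e` at `0`.
  have h1 : (f - f.1 x • schrodinger d hψ ⟨-x, 0, 0⟩ e).1 x = 0 := by
    change f.1 x - f.1 x * (schrodinger d hψ ⟨-x, 0, 0⟩ e).1 x = 0
    rw [hρ, Schw.ball_of_le one_pos (by simp)]
    ring
  have h2 := apply_eq_zero_of_commute hψ hψ1 T hT _ h1
  rw [map_sub, map_smul, ← hT] at h2
  change (T f).1 x - f.1 x * (schrodinger d hψ ⟨-x, 0, 0⟩ (T e)).1 x = 0 at h2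
  rw [hρ] at h2
  change (T f).1 x = (T e).1 0 * f.1 x
  rw [sub_eq_zero.1 h2, mul_comm]

theorem exists_schw_ne_zero : ∃ f : Schw p d, f ≠ 0 :=
  ⟨Schw.ball p d one_pos, fun h => one_ne_zero (α := ℂ_[p]) <| by
    rw [← Schw.ball_of_le (d := d) one_pos (x := (0 : Fin d → ℚ_[p])) (by simp), h]; rfl⟩

/-- Intertwining operators corresponding to the same matrix are proportional. -/
theorem IsIntertwiner.exists_smul {hψ : IsSmoothChar ψ} (hψ1 : ψ ≠ 1)
    {g : Matrix.symplecticGroup (Fin d) ℚ_[p]} {T T' : Schw p d ≃ₗ[ℂ_[p]] Schw p d}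
    (hT : IsIntertwiner hψ g T) (hT' : IsIntertwiner hψ g T') :
    ∃ c : ℂ_[p], c ≠ 0 ∧ ∀ f, T' f = c • T f := by
  -- The two twists by `g` cancel in `T' ∘ T⁻¹`, which therefore commutes with the representation.
  obtain ⟨c, hc⟩ := exists_eq_smul_of_commute hψ hψ1 (T'.toLinearMap ∘ₗ T.symm.toLinearMap)
    (fun h f => by
      have h1 : T.symm (schrodinger d hψ h f) = schrodinger d hψ (h.act g.1) (T.symm f) := by
        rw [LinearEquiv.symm_apply_eq, ← hT, LinearEquiv.apply_symm_apply]
      change schrodinger d hψ h (T' (T.symm f)) = T' (T.symm (schrodinger d hψ h f))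
      rw [h1, hT'])
  have hc' : ∀ f, T' f = c • T f := fun f => by simpa using hc (T f)
  refine ⟨c, ?_, hc'⟩
  rintro rfl
  obtain ⟨f, hf⟩ := exists_schw_ne_zero (p := p) (d := d)
  exact hf (T'.map_eq_zero_iff.1 (by rw [hc', zero_smul]))

/-! ## Integration -/

/-- The lattice of vectors of norm at most `p ^ (-n)`. -/
def lattice (p : ℕ) [Fact p.Prime] (d n : ℕ) : AddSubgroup (Fin d → ℚ_[p]) where
  carrier := {x | ‖x‖ ≤ (p : ℝ)⁻¹ ^ n}
  zero_mem' := by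
    change ‖(0 : Fin d → ℚ_[p])‖ ≤ _
    rw [norm_zero]; positivity
  add_mem' := fun hx hy => (IsUltrametricDist.norm_add_le_max _ _).trans (max_le hx hy)
  neg_mem' := fun {x} hx => by
    change ‖-x‖ ≤ _
    rw [norm_neg]; exact hx

theorem mem_lattice {n : ℕ} {x : Fin d → ℚ_[p]} :
    x ∈ lattice p d n ↔ ‖x‖ ≤ (p : ℝ)⁻¹ ^ n := Iff.rfl

theorem inv_prime_pow_pos (n : ℕ) : 0 < (p : ℝ)⁻¹ ^ n :=
  pow_pos (inv_pos.2 (Nat.cast_pos.2 (Fact.out : p.Prime).pos)) n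

theorem lattice_antitone : Antitone (lattice p d) := fun m n hmn x hx => by
  rw [mem_lattice] at *
  refine hx.trans (pow_le_pow_of_le_one (inv_nonneg.2 (Nat.cast_nonneg p)) ?_ hmn)
  exact inv_le_one_of_one_le₀ (Nat.one_le_cast.2 (Fact.out : p.Prime).one_lt.le)

theorem coe_lattice (n : ℕ) :
    (lattice p d n : Set (Fin d → ℚ_[p])) = Metric.closedBall 0 ((p : ℝ)⁻¹ ^ n) := by
  ext x
  rw [SetLike.mem_coe, mem_lattice, mem_closedBall_zero_iff]

theorem isOpen_lattice (n : ℕ) : IsOpen (lattice p d n : Set (Fin d → ℚ_[p])) := by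
  rw [coe_lattice]
  exact IsUltrametricDist.isOpen_closedBall _ (inv_prime_pow_pos n).ne'

theorem exists_lattice_radius_le {δ : ℝ} (hδ : 0 < δ) : ∃ n : ℕ, (p : ℝ)⁻¹ ^ n ≤ δ := by
  obtain ⟨n, hn⟩ := exists_pow_lt_of_lt_one hδ
    (inv_lt_one_of_one_lt₀ (Nat.one_lt_cast.2 (Fact.out : p.Prime).one_lt) : (p : ℝ)⁻¹ < 1)
  exact ⟨n, hn.le⟩

instance discreteTopology_quotient_lattice (n : ℕ) :
    DiscreteTopology ((Fin d → ℚ_[p]) ⧸ lattice p d n) :=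
  QuotientAddGroup.discreteTopology (isOpen_lattice n)

instance finite_lattice_quotient (m n : ℕ) :
    Finite (lattice p d n ⧸ (lattice p d m).addSubgroupOf (lattice p d n)) := by
  have : CompactSpace (lattice p d n) := by
    refine isCompact_iff_compactSpace.1 (?_ : IsCompact (lattice p d n : Set (Fin d → ℚ_[p])))
    rw [coe_lattice]
    exact isCompact_closedBall _ _
  exact AddSubgroup.quotient_finite_of_isOpen _ ((isOpen_lattice m).preimage continuous_subtype_val)

theorem relIndex_lattice_ne_zero (m n : ℕ) : (lattice p d m).relIndex (lattice p d n) ≠ 0 :=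
  Nat.card_ne_zero.2 ⟨inferInstance, finite_lattice_quotient m n⟩

/-- A function is invariant under translations by a lattice. -/
def LatticeInvariant (n : ℕ) (f : Schw p d) : Prop :=
  ∀ x, ∀ y ∈ lattice p d n, f.1 (x + y) = f.1 x

theorem LatticeInvariant.mono {m n : ℕ} {f : Schw p d} (hf : LatticeInvariant n f) (h : n ≤ m) :
    LatticeInvariant m f := fun x y hy => hf x y (lattice_antitone h hy)

theorem Schw.exists_latticeInvariant (f : Schw p d) : ∃ n, LatticeInvariant n f := by
  obtain ⟨δ, hδ, h⟩ := Schw.exists_invariant f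
  obtain ⟨n, hn⟩ := exists_lattice_radius_le (p := p) hδ
  exact ⟨n, fun x y hy => h x y ((mem_lattice.1 hy).trans hn)⟩

theorem LatticeInvariant.apply_eq {n : ℕ} {f : Schw p d} (hf : LatticeInvariant n f)
    {x y : Fin d → ℚ_[p]}
    (h : (x : (Fin d → ℚ_[p]) ⧸ lattice p d n) = y) : f.1 x = f.1 y := by
  have := hf x (-x + y) (QuotientAddGroup.eq.1 h)
  rw [← this, add_neg_cancel_left]

theorem LatticeInvariant.apply_out {n : ℕ} {f : Schw p d} (hf : LatticeInvariant n f)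
    (x : Fin d → ℚ_[p]) :
    f.1 (x : (Fin d → ℚ_[p]) ⧸ lattice p d n).out = f.1 x :=
  hf.apply_eq (QuotientAddGroup.out_eq' _)

/-- The sum of the values of `f` on representatives of the cosets of a lattice. -/
noncomputable def cosetSum (n : ℕ) (f : Schw p d) : ℂ_[p] :=
  ∑ᶠ q : (Fin d → ℚ_[p]) ⧸ lattice p d n, f.1 q.out

/-- The compact support has finite image in the discrete quotient; without this finiteness the
`finsum` would take its default value 0. -/
theorem finite_support_out (n : ℕ) (f : Schw p d) :
    (Function.support fun q : (Fin d → ℚ_[p]) ⧸ lattice p d n => f.1 q.out).Finite := by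
  have h : (QuotientAddGroup.mk '' tsupport f.1 :
      Set ((Fin d → ℚ_[p]) ⧸ lattice p d n)).Finite :=
    (f.2.2.isCompact.image QuotientAddGroup.continuous_mk).finite_of_discrete
  refine h.subset fun q hq => ⟨q.out, subset_tsupport _ hq, QuotientAddGroup.out_eq' q⟩

/-- Every coset of the larger lattice splits into `relIndex` many cosets of the smaller one, and `f`
is constant on it. -/
theorem cosetSum_eq_relIndex_mul {m n : ℕ} {f : Schw p d} (hf : LatticeInvariant n f)
    (h : n ≤ m) :
    cosetSum m f = (lattice p d m).relIndex (lattice p d n) * cosetSum n f := by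
  let e := AddSubgroup.quotientEquivProdOfLE (lattice_antitone (p := p) (d := d) h)
  have he : ∀ q, f.1 q.out = f.1 (e q).1.out := fun q => by
    conv_rhs => rw [← QuotientAddGroup.out_eq' q]
    exact (hf.apply_out q.out).symm
  have h1 : cosetSum m f = ∑ᶠ z : ((Fin d → ℚ_[p]) ⧸ lattice p d n) ×
      (lattice p d n ⧸ (lattice p d m).addSubgroupOf (lattice p d n)), f.1 z.1.out := by
    rw [← finsum_comp_equiv e]
    exact finsum_congr he
  rw [h1, finsum_curry]
  · have : Fintype (lattice p d n ⧸ (lattice p d m).addSubgroupOf (lattice p d n)) :=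
      Fintype.ofFinite _
    simp only [finsum_eq_sum_of_fintype, Finset.sum_const, Finset.card_univ]
    rw [cosetSum, mul_finsum]
    refine finsum_congr fun q => ?_
    rw [nsmul_eq_mul, AddSubgroup.relIndex, AddSubgroup.index, Nat.card_eq_fintype_card]
  · refine ((finite_support_out n f).prod (Set.finite_univ (α :=
      lattice p d n ⧸ (lattice p d m).addSubgroupOf (lattice p d n)))).subset fun z hz => ?_
    exact ⟨hz, Set.mem_univ _⟩

/-- The translation invariant integral with values in `ℂ_[p]`, normalised on the unit ball. -/
noncomputable def integralAt (n : ℕ) (f : Schw p d) : ℂ_[p] :=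
  ((lattice p d n).relIndex (lattice p d 0) : ℂ_[p])⁻¹ * cosetSum n f

/-- The factor from refining the lattice cancels by multiplicativity of indices; the indices are
finite and stay nonzero in `ℂ_[p]`, which has characteristic 0. -/
theorem integralAt_eq {m n : ℕ} {f : Schw p d} (hf : LatticeInvariant n f) (h : n ≤ m) :
    integralAt m f = integralAt n f := by
  have h1 := AddSubgroup.relIndex_mul_relIndex _ _ _
    (lattice_antitone (p := p) (d := d) h) (lattice_antitone n.zero_le)
  have h2 : ((lattice p d m).relIndex (lattice p d n) : ℂ_[p]) ≠ 0 :=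
    Nat.cast_ne_zero.2 (relIndex_lattice_ne_zero m n)
  rw [integralAt, integralAt, cosetSum_eq_relIndex_mul hf h, ← h1, Nat.cast_mul]
  field_simp

theorem integralAt_eq_integralAt {m n : ℕ} {f : Schw p d} (hm : LatticeInvariant m f)
    (hn : LatticeInvariant n f) : integralAt m f = integralAt n f := by
  rw [← integralAt_eq hm (le_max_left m n), ← integralAt_eq hn (le_max_right m n)]

/-- The translation invariant `ℂ_[p]`-valued integral on Schwartz functions, normalised so that
the unit ball has volume `1`. -/
noncomputable def integral (p : ℕ) [Fact p.Prime] (d : ℕ) : Schw p d →ₗ[ℂ_[p]] ℂ_[p] :=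
  have key : ∀ {n : ℕ} {f : Schw p d}, LatticeInvariant n f →
      integralAt (Schw.exists_latticeInvariant f).choose f = integralAt n f :=
    fun {_ f} hn => integralAt_eq_integralAt (Schw.exists_latticeInvariant f).choose_spec hn
  { toFun f := integralAt (Schw.exists_latticeInvariant f).choose f
    map_add' f g := by
      obtain ⟨m, hm⟩ := Schw.exists_latticeInvariant f
      obtain ⟨n, hn⟩ := Schw.exists_latticeInvariant g
      have hm' := hm.mono (le_max_left m n)
      have hn' := hn.mono (le_max_right m n)
      have hmn : LatticeInvariant (max m n) (f + g) := fun x y hy => by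
        change f.1 (x + y) + g.1 (x + y) = f.1 x + g.1 x
        rw [hm' x y hy, hn' x y hy]
      rw [key hm', key hn', key hmn, integralAt, integralAt, integralAt, ← mul_add, cosetSum,
        cosetSum, cosetSum,
        ← finsum_add_distrib (finite_support_out _ f) (finite_support_out _ g)]
      rfl
    map_smul' c f := by
      obtain ⟨n, hn⟩ := Schw.exists_latticeInvariant f
      have hcn : LatticeInvariant n (c • f) := fun x y hy => by
        change c * f.1 (x + y) = c * f.1 x
        rw [hn x y hy]
      rw [key hn, key hcn, integralAt, integralAt, RingHom.id_apply, smul_eq_mul, mul_left_comm,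
        cosetSum, cosetSum, mul_finsum _ c]
      rfl }

theorem integral_eq {n : ℕ} {f : Schw p d} (hf : LatticeInvariant n f) :
    integral p d f = integralAt n f :=
  integralAt_eq_integralAt (Schw.exists_latticeInvariant f).choose_spec hf

/-- Translation permutes the cosets of a lattice, and the choice of representatives is immaterial
for an invariant function. -/
theorem integral_eq_of_translate {f g : Schw p d} (a : Fin d → ℚ_[p])
    (h : ∀ x, g.1 x = f.1 (x + a)) : integral p d g = integral p d f := by
  obtain ⟨n, hn⟩ := Schw.exists_latticeInvariant f
  have hg : LatticeInvariant n g := fun x y hy => by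
    rw [h, h, add_right_comm, hn _ y hy]
  rw [integral_eq hn, integral_eq hg, integralAt, integralAt, cosetSum, cosetSum,
    ← finsum_comp_equiv (Equiv.addRight (a : (Fin d → ℚ_[p]) ⧸ lattice p d n))
      (f := fun q => f.1 q.out)]
  congr 1
  refine finsum_congr fun q => ?_
  rw [h]
  refine (hn.apply_out (q.out + a)).symm.trans ?_
  rw [Equiv.coe_addRight, QuotientAddGroup.mk_add, QuotientAddGroup.out_eq']

/-- The volume of a nonempty compact open set does not vanish. -/
theorem integral_ne_zero {f : Schw p d} (h01 : ∀ x, f.1 x = 0 ∨ f.1 x = 1)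
    (hf : ∃ x, f.1 x ≠ 0) : integral p d f ≠ 0 := by
  obtain ⟨n, hn⟩ := Schw.exists_latticeInvariant f
  rw [integral_eq hn, integralAt]
  refine mul_ne_zero (inv_ne_zero (Nat.cast_ne_zero.2 (relIndex_lattice_ne_zero n 0))) ?_
  have hfin := finite_support_out n f
  -- The sum counts the cosets on which `f` is 1: a positive integer, nonzero in characteristic 0.
  rw [cosetSum, finsum_eq_sum_of_support_subset (s := hfin.toFinset) _ (by simp)]
  rw [Finset.sum_congr rfl (g := fun _ => (1 : ℂ_[p]))]
  · obtain ⟨x, hx⟩ := hf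
    rw [Finset.sum_const, nsmul_one, Nat.cast_ne_zero]
    refine Finset.card_ne_zero_of_mem (a := (x : (Fin d → ℚ_[p]) ⧸ lattice p d n)) ?_
    rwa [Set.Finite.mem_toFinset, Function.mem_support, hn.apply_out]
  · intro q hq
    rw [Set.Finite.mem_toFinset, Function.mem_support] at hq
    exact (h01 _).resolve_left hq

/-! ## The Fourier transform -/

theorem norm_dotProduct_le (x y : Fin d → ℚ_[p]) : ‖x ⬝ᵥ y‖ ≤ ‖x‖ * ‖y‖ := by
  refine IsUltrametricDist.norm_sum_le_of_forall_le_of_nonneg (by positivity) fun i _ => ?_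
  rw [norm_mul]
  exact mul_le_mul (norm_le_pi_norm x i) (norm_le_pi_norm y i) (norm_nonneg _) (norm_nonneg _)

theorem IsSmoothChar.exists_trivial (hψ : IsSmoothChar ψ) :
    ∃ ε : ℝ, 0 < ε ∧ ∀ t, ‖t‖ ≤ ε → ψ t = 1 := by
  have h : {t : ℚ_[p] | ψ t = 1} ∈ nhds (0 : ℚ_[p]) := hψ.mem_nhds (by simp)
  obtain ⟨ε, hε, h⟩ := Metric.nhds_basis_closedBall.mem_iff.1 h
  exact ⟨ε, hε, fun t ht => h (by simpa using ht)⟩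

/-- The Fourier transform of `f` at `x`. -/
noncomputable def fourierFun (hψ : IsSmoothChar ψ) (f : Schw p d) (x : Fin d → ℚ_[p]) : ℂ_[p] :=
  integral p d (schrodinger d hψ ⟨0, -x, 0⟩ f)

theorem schrodinger_modulation (hψ : IsSmoothChar ψ) (v : Fin d → ℚ_[p]) (f : Schw p d)
    (y : Fin d → ℚ_[p]) : (schrodinger d hψ ⟨0, v, 0⟩ f).1 y = ψ (v ⬝ᵥ y) * f.1 y := by
  simp [schrodinger_apply]

theorem isLocallyConstant_fourierFun (hψ : IsSmoothChar ψ) (f : Schw p d) :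
    IsLocallyConstant (fourierFun hψ f) := by
  obtain ⟨R, hR, hf⟩ := Schw.exists_bound_support f
  obtain ⟨ε, hε, hψε⟩ := hψ.exists_trivial
  rw [IsLocallyConstant.iff_exists_open]
  -- With this radius `(x' - x) ⬝ᵥ y` has norm at most `ε` on the support of `f`, where `ψ` cannot
  -- distinguish the two integrands.
  refine fun x => ⟨Metric.ball x (ε / R), Metric.isOpen_ball,
    Metric.mem_ball_self (by positivity), fun x' hx' => ?_⟩
  rw [mem_ball_iff_norm] at hx'
  unfold fourierFun
  congr 1
  refine Subtype.ext (funext fun y => ?_)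
  rw [schrodinger_modulation, schrodinger_modulation]
  by_cases hy : ‖y‖ ≤ R
  · have h1 : ψ (-(x' - x) ⬝ᵥ y) = 1 := by
      refine hψε _ ((norm_dotProduct_le _ _).trans ?_)
      rw [norm_neg]
      calc ‖x' - x‖ * ‖y‖ ≤ ε / R * R :=
            mul_le_mul hx'.le hy (norm_nonneg _) (by positivity)
        _ = ε := div_mul_cancel₀ _ hR.ne'
    have h2 : -x' = -(x' - x) + -x := by abel
    rw [h2, add_dotProduct, ψ.map_add_eq_mul, h1, one_mul]
  · rw [hf y (not_le.1 hy), mul_zero, mul_zero]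

/-- Substituting `z ↦ z + y` multiplies the integral by `ψ(-x ⬝ᵥ y) ≠ 1` and leaves it unchanged. -/
theorem fourierFun_eq_zero (hψ : IsSmoothChar ψ) (f : Schw p d) {x y : Fin d → ℚ_[p]}
    (hf : ∀ z, f.1 (z + y) = f.1 z) (hxy : ψ (-x ⬝ᵥ y) ≠ 1) : fourierFun hψ f x = 0 := by
  have h : integral p d (ψ (-x ⬝ᵥ y) • schrodinger d hψ ⟨0, -x, 0⟩ f) =
      integral p d (schrodinger d hψ ⟨0, -x, 0⟩ f) :=
    integral_eq_of_translate y fun z => by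
      change ψ (-x ⬝ᵥ y) * (schrodinger d hψ ⟨0, -x, 0⟩ f).1 z = _
      rw [schrodinger_modulation, schrodinger_modulation, hf, dotProduct_add, ψ.map_add_eq_mul]
      ring
  rw [map_smul, smul_eq_mul] at h
  by_contra h0
  exact hxy (mul_right_cancel₀ h0 (by rw [one_mul]; exact h))

theorem hasCompactSupport_fourierFun (hψ : IsSmoothChar ψ) (hψ1 : ψ ≠ 1) (f : Schw p d) :
    HasCompactSupport (fourierFun hψ f) := by
  obtain ⟨δ, hδ, hf⟩ := Schw.exists_invariant f
  obtain ⟨t, ht⟩ := exists_apply_ne_one hψ1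
  refine HasCompactSupport.intro (isCompact_closedBall (0 : Fin d → ℚ_[p]) (‖t‖ / δ))
    fun x hx => ?_
  rw [mem_closedBall_zero_iff, pi_norm_le_iff_of_nonneg (by positivity)] at hx
  push Not at hx
  obtain ⟨i, hi⟩ := hx
  have hxi : 0 < ‖x i‖ := lt_of_le_of_lt (by positivity) hi
  have hxi' : x i ≠ 0 := norm_pos_iff.1 hxi
  -- This period makes `-x ⬝ᵥ y = t`, and it is short enough for `f` because `x i` is large.
  refine fourierFun_eq_zero hψ f (y := Pi.single i (-t / x i)) (fun z => hf _ _ ?_) ?_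
  · rw [Pi.norm_single, norm_div, norm_neg, div_le_iff₀ hxi]
    rw [div_lt_iff₀ hδ] at hi
    linarith
  · rw [dotProduct_single, Pi.neg_apply]
    convert ht using 2
    field_simp

/-- The Fourier transform on Schwartz functions. -/
noncomputable def fourier (hψ : IsSmoothChar ψ) (hψ1 : ψ ≠ 1) : Schw p d →ₗ[ℂ_[p]] Schw p d where
  toFun f := ⟨fourierFun hψ f,
    isLocallyConstant_fourierFun hψ f, hasCompactSupport_fourierFun hψ hψ1 f⟩
  map_add' f g := Subtype.ext (funext fun x => by
    change fourierFun hψ (f + g) x = fourierFun hψ f x + fourierFun hψ g x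
    simp only [fourierFun, map_add])
  map_smul' c f := Subtype.ext (funext fun x => by
    change fourierFun hψ (c • f) x = c • fourierFun hψ f x
    simp only [fourierFun, map_smul])

theorem fourier_apply (hψ : IsSmoothChar ψ) (hψ1 : ψ ≠ 1) (f : Schw p d) (x : Fin d → ℚ_[p]) :
    (fourier hψ hψ1 f).1 x = integral p d (schrodinger d hψ ⟨0, -x, 0⟩ f) := rfl

/-- The Fourier transform exchanges translations and modulations; the identity is the substitution
`y ↦ y + h.y` under the integral. -/
theorem schrodinger_fourier (hψ : IsSmoothChar ψ) (hψ1 : ψ ≠ 1) (h : Heis p d) (f : Schw p d) :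
    schrodinger d hψ h (fourier hψ hψ1 f) =
      fourier hψ hψ1 (schrodinger d hψ ⟨h.y, -h.x, h.t⟩ f) := by
  refine Subtype.ext (funext fun x => ?_)
  rw [schrodinger_apply, fourier_apply, fourier_apply, ← smul_eq_mul, ← map_smul]
  symm
  refine integral_eq_of_translate h.y fun y => ?_
  change _ = ψ _ * (schrodinger d hψ _ f).1 (y + h.y)
  rw [schrodinger_modulation, schrodinger_modulation, schrodinger_apply, ← mul_assoc, ← mul_assoc,
    ← ψ.map_add_eq_mul, ← ψ.map_add_eq_mul]
  congr 2
  simp only [add_dotProduct, dotProduct_add, neg_dotProduct, dotProduct_neg, neg_add]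
  rw [dotProduct_comm h.y h.x, dotProduct_comm h.y x]
  ring

/-- The reflection `f ↦ (x ↦ f (-x))`. -/
noncomputable def reflection (p : ℕ) [Fact p.Prime] (d : ℕ) : Schw p d →ₗ[ℂ_[p]] Schw p d where
  toFun f := ⟨fun x => f.1 (-x), f.2.1.comp_continuous continuous_neg,
    f.2.2.comp_homeomorph (Homeomorph.neg _)⟩
  map_add' _ _ := rfl
  map_smul' _ _ := rfl

theorem reflection_apply (f : Schw p d) (x : Fin d → ℚ_[p]) :
    (reflection p d f).1 x = f.1 (-x) := rfl

theorem reflection_reflection (f : Schw p d) : reflection p d (reflection p d f) = f :=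
  Subtype.ext (funext fun x => by rw [reflection_apply, reflection_apply, neg_neg])

theorem schrodinger_reflection (hψ : IsSmoothChar ψ) (h : Heis p d) (f : Schw p d) :
    schrodinger d hψ ⟨-h.x, -h.y, h.t⟩ (reflection p d f) =
      reflection p d (schrodinger d hψ h f) :=
  Subtype.ext (funext fun x => by
    simp only [schrodinger_apply, reflection_apply, neg_dotProduct, dotProduct_neg, neg_neg,
      neg_add])

/-- Fourier inversion up to a nonzero constant. -/
theorem exists_fourier_fourier (hψ : IsSmoothChar ψ) (hψ1 : ψ ≠ 1) :
    ∃ c : ℂ_[p], c ≠ 0 ∧ ∀ f : Schw p d,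
      fourier hψ hψ1 (fourier hψ hψ1 f) = c • reflection p d f := by
  -- Two Fourier transforms negate both coordinates of the Heisenberg element and the reflection
  -- negates them back, so Schur's lemma applies to the composite.
  obtain ⟨c, hc⟩ := exists_eq_smul_of_commute hψ hψ1
    (fourier hψ hψ1 ∘ₗ fourier hψ hψ1 ∘ₗ reflection p d) (fun h f => by
      simp only [LinearMap.comp_apply]
      rw [schrodinger_fourier, schrodinger_fourier, ← schrodinger_reflection])
  have hc' : ∀ f : Schw p d, fourier hψ hψ1 (fourier hψ hψ1 f) = c • reflection p d f := fun f => by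
    have := hc (reflection p d f)
    simpa only [LinearMap.comp_apply, reflection_reflection] using this
  refine ⟨c, ?_, hc'⟩
  rintro rfl
  let e := Schw.ball p d one_pos
  have he01 : ∀ x, e.1 x = 0 ∨ e.1 x = 1 := fun x => by
    rcases le_or_gt ‖x‖ 1 with h | h
    · exact Or.inr (Schw.ball_of_le _ h)
    · exact Or.inl (Schw.ball_of_lt _ h)
  have he0 : integral p d e ≠ 0 :=
    integral_ne_zero he01 ⟨0, by rw [Schw.ball_of_le one_pos (by simp)]; exact one_ne_zero⟩
  -- The transform of the unit ball is a nonzero constant times a nonempty indicator function, so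
  -- its integral, which is the double transform at `0`, cannot vanish. This excludes `c = 0`.
  have hF : ∀ x, (fourier hψ hψ1 e).1 x = 0 ∨ (fourier hψ hψ1 e).1 x = integral p d e := by
    intro x
    by_cases hx : ∀ y : Fin d → ℚ_[p], ‖y‖ ≤ 1 → ψ (-x ⬝ᵥ y) = 1
    · right
      rw [fourier_apply]
      congr 1
      refine Subtype.ext (funext fun y => ?_)
      rw [schrodinger_modulation]
      rcases le_or_gt ‖y‖ 1 with h | h
      · rw [hx y h, one_mul]
      · rw [Schw.ball_of_lt _ h, mul_zero]
    · left
      push Not at hx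
      obtain ⟨y, hy, hxy⟩ := hx
      refine fourierFun_eq_zero hψ e (fun z => ?_) hxy
      rcases le_or_gt ‖z‖ 1 with h | h
      · rw [Schw.ball_of_le _ h, Schw.ball_of_le]
        exact (IsUltrametricDist.norm_add_le_max _ _).trans (max_le h hy)
      · rw [Schw.ball_of_lt _ h, Schw.ball_of_lt]
        rwa [norm_add_eq_left_of_lt (hy.trans_lt h)]
  have hzero : ∀ f : Schw p d, (fourier hψ hψ1 f).1 0 = integral p d f := fun f => by
    rw [fourier_apply]
    congr 1
    refine Subtype.ext (funext fun y => ?_)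
    rw [schrodinger_modulation]
    simp
  refine integral_ne_zero (f := (integral p d e)⁻¹ • fourier hψ hψ1 e) (fun x => ?_) ⟨0, ?_⟩ ?_
  · change (integral p d e)⁻¹ * (fourier hψ hψ1 e).1 x = 0 ∨
      (integral p d e)⁻¹ * (fourier hψ hψ1 e).1 x = 1
    rcases hF x with h | h <;> rw [h]
    · simp
    · exact Or.inr (inv_mul_cancel₀ he0)
  · change (integral p d e)⁻¹ * (fourier hψ hψ1 e).1 0 ≠ 0
    rw [hzero, inv_mul_cancel₀ he0]
    exact one_ne_zero
  · rw [map_smul, ← hzero (fourier hψ hψ1 e), hc', zero_smul]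
    exact smul_zero _

theorem bijective_fourier (hψ : IsSmoothChar ψ) (hψ1 : ψ ≠ 1) :
    Function.Bijective (fourier (d := d) hψ hψ1) := by
  obtain ⟨c, hc, h⟩ := exists_fourier_fourier (d := d) hψ hψ1
  constructor
  · rw [injective_iff_map_eq_zero]
    intro f hf
    have h1 := h f
    rw [hf, map_zero] at h1
    have h2 := (smul_eq_zero.1 h1.symm).resolve_left hc
    rw [← reflection_reflection f, h2, map_zero]
  · intro f
    refine ⟨c⁻¹ • fourier hψ hψ1 (reflection p d f), ?_⟩
    rw [map_smul, h, reflection_reflection, smul_smul, inv_mul_cancel₀ hc, one_smul]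

/-- `Matrix.J` has upper right block `-1`, so on row vectors it is `(x, y) ↦ (y, -x)`, exactly the
twist in `schrodinger_fourier`. -/
theorem exists_isIntertwiner_symJ (hψ : IsSmoothChar ψ) (hψ1 : ψ ≠ 1) :
    ∃ T, IsIntertwiner (d := d) hψ (SymplecticGroup.symJ (Fin d) ℚ_[p]) T := by
  refine ⟨LinearEquiv.ofBijective _ (bijective_fourier hψ hψ1), fun h f => ?_⟩
  refine (schrodinger_fourier hψ hψ1 h f).trans ?_
  change _ = fourier hψ hψ1 _
  congr 3
  ext1 <;> simp [Heis.act, SymplecticGroup.coe_J, Matrix.J, Matrix.vecMul_neg]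

/-! ## Existence of intertwining operators -/

/-- The function `x ↦ ψ(q x) f(e x)`. -/
noncomputable def twistFun (hψ : IsSmoothChar ψ) (e : (Fin d → ℚ_[p]) ≃ₜ (Fin d → ℚ_[p]))
    {q : (Fin d → ℚ_[p]) → ℚ_[p]} (hq : Continuous q) (f : Schw p d) : Schw p d :=
  ⟨fun x => ψ (q x) * f.1 (e x),
    (hψ.isLocallyConstant.comp_continuous hq).mul (f.2.1.comp_continuous e.continuous),
    (f.2.2.comp_homeomorph e).mul_left⟩

/-- The operator `f ↦ (x ↦ ψ(q x) f(e x))`. -/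
noncomputable def twist (hψ : IsSmoothChar ψ) (e : (Fin d → ℚ_[p]) ≃ₜ (Fin d → ℚ_[p]))
    {q : (Fin d → ℚ_[p]) → ℚ_[p]} (hq : Continuous q) : Schw p d ≃ₗ[ℂ_[p]] Schw p d where
  toFun := twistFun hψ e hq
  invFun := twistFun hψ e.symm (q := fun x => -q (e.symm x)) (by fun_prop)
  map_add' f g := Subtype.ext (funext fun x => mul_add _ _ _)
  map_smul' c f := Subtype.ext (funext fun x => mul_left_comm _ _ _)
  left_inv f := Subtype.ext (funext fun x => by
    simp only [twistFun, Homeomorph.apply_symm_apply]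
    rw [← mul_assoc, ← ψ.map_add_eq_mul, neg_add_cancel, ψ.map_zero_eq_one, one_mul])
  right_inv f := Subtype.ext (funext fun x => by
    simp only [twistFun, Homeomorph.symm_apply_apply]
    rw [← mul_assoc, ← ψ.map_add_eq_mul, add_neg_cancel, ψ.map_zero_eq_one, one_mul])

theorem twist_apply (hψ : IsSmoothChar ψ) (e : (Fin d → ℚ_[p]) ≃ₜ (Fin d → ℚ_[p]))
    {q : (Fin d → ℚ_[p]) → ℚ_[p]} (hq : Continuous q) (f : Schw p d) (x : Fin d → ℚ_[p]) :
    (twist hψ e hq f).1 x = ψ (q x) * f.1 (e x) := rfl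

theorem supNorm_twist (hψ : IsSmoothChar ψ) (e : (Fin d → ℚ_[p]) ≃ₜ (Fin d → ℚ_[p]))
    {q : (Fin d → ℚ_[p]) → ℚ_[p]} (hq : Continuous q) (f : Schw p d) :
    supNorm p d (twist hψ e hq f) = supNorm p d f := by
  change ⨆ x, ‖ψ (q x) * f.1 (e x)‖ = ⨆ x, ‖f.1 x‖
  simp only [norm_mul, hψ.norm_eq_one, one_mul]
  exact e.toEquiv.iSup_congr fun x => rfl

theorem vecMul_dotProduct_vecMul {n R : Type*} [Fintype n] [CommRing R] (x y : n → R)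
    (M N : Matrix n n R) :
    (x ᵥ* M) ⬝ᵥ (y ᵥ* N) = (x ᵥ* (M * Nᵀ)) ⬝ᵥ y := by
  rw [← Matrix.mulVec_transpose N y, Matrix.dotProduct_mulVec, Matrix.vecMul_vecMul]

/-- The linear automorphism `x ↦ x ᵥ* M`. -/
noncomputable def vecMulHomeomorph {M N : Matrix (Fin d) (Fin d) ℚ_[p]} (h : M * N = 1) :
    (Fin d → ℚ_[p]) ≃ₜ (Fin d → ℚ_[p]) where
  toFun x := x ᵥ* M
  invFun x := x ᵥ* N
  left_inv x := by beta_reduce; rw [Matrix.vecMul_vecMul, h, Matrix.vecMul_one]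
  right_inv x := by beta_reduce; rw [Matrix.vecMul_vecMul, mul_eq_one_comm.1 h, Matrix.vecMul_one]
  continuous_toFun := continuous_id.matrix_vecMul continuous_const
  continuous_invFun := continuous_id.matrix_vecMul continuous_const

theorem vecMulHomeomorph_apply {M N : Matrix (Fin d) (Fin d) ℚ_[p]} (h : M * N = 1)
    (x : Fin d → ℚ_[p]) : vecMulHomeomorph h x = x ᵥ* M := rfl

/-- The elements of the Siegel parabolic have intertwining operators preserving the sup norm. -/
theorem exists_isIntertwiner_of_toBlocks₂₁_eq_zero (hψ : IsSmoothChar ψ)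
    (g : Matrix.symplecticGroup (Fin d) ℚ_[p]) (hg : g.1.toBlocks₂₁ = 0) :
    ∃ T, IsIntertwiner hψ g T ∧ ∀ f, supNorm p d (T f) = supNorm p d f := by
  obtain ⟨A, hA⟩ : ∃ A, A = g.1.toBlocks₁₁ := ⟨_, rfl⟩
  obtain ⟨B, hB⟩ : ∃ B, B = g.1.toBlocks₁₂ := ⟨_, rfl⟩
  obtain ⟨D, hD⟩ : ∃ D, D = g.1.toBlocks₂₂ := ⟨_, rfl⟩
  -- The action is on row vectors, so the relations needed are those of the transpose: `A * Bᵀ` is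
  -- symmetric and `A * Dᵀ = 1`.
  have h1 := SymplecticGroup.transpose_mem g.2
  rw [← Matrix.fromBlocks_toBlocks g.1, Matrix.fromBlocks_transpose, hg, ← hA, ← hB, ← hD,
    SymplecticGroup.fromBlocks_mem_iff] at h1
  simp only [Matrix.transpose_transpose, Matrix.transpose_zero, Matrix.mul_zero, sub_zero] at h1
  obtain ⟨hAB, -, hAD⟩ := h1
  have hq : Continuous fun x : Fin d → ℚ_[p] => 1 / 2 * ((x ᵥ* A) ⬝ᵥ (x ᵥ* B)) :=
    (continuous_const (y := (1 / 2 : ℚ_[p]))).mul ((continuous_id.matrix_vecMul continuous_const).dotProduct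
      (continuous_id.matrix_vecMul continuous_const))
  refine ⟨twist hψ (vecMulHomeomorph hAD) hq, fun h f => Subtype.ext (funext fun x => ?_),
    supNorm_twist hψ _ hq⟩
  have hsym : ∀ y z : Fin d → ℚ_[p], (y ᵥ* A) ⬝ᵥ (z ᵥ* B) = (z ᵥ* A) ⬝ᵥ (y ᵥ* B) := fun y z => by
    rw [vecMul_dotProduct_vecMul, hAB, ← vecMul_dotProduct_vecMul, dotProduct_comm]
  have hdual : ∀ y z : Fin d → ℚ_[p], (y ᵥ* A) ⬝ᵥ (z ᵥ* D) = y ⬝ᵥ z := fun y z => by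
    rw [vecMul_dotProduct_vecMul, hAD, Matrix.vecMul_one]
  have hact : h.act g.1 = ⟨h.x ᵥ* A, h.x ᵥ* B + h.y ᵥ* D, h.t⟩ := by
    rw [hA, hB, hD]
    ext1
    · simp only [Heis.act, hg, Matrix.vecMul_zero, add_zero]
    · rfl
    · rfl
  rw [hact, schrodinger_apply, twist_apply, twist_apply, schrodinger_apply, ← mul_assoc,
    ← mul_assoc, ← ψ.map_add_eq_mul, ← ψ.map_add_eq_mul]
  congr 2
  · simp only [vecMulHomeomorph_apply, Matrix.add_vecMul, dotProduct_add, add_dotProduct]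
    rw [dotProduct_comm (h.x ᵥ* B) (x ᵥ* A), dotProduct_comm (h.y ᵥ* D) (x ᵥ* A), hdual, hdual,
      hsym h.x x, dotProduct_comm h.y x]
    ring
  · simp only [vecMulHomeomorph_apply, Matrix.add_vecMul]

theorem IsIntertwiner.mul {hψ : IsSmoothChar ψ} {g g' : Matrix.symplecticGroup (Fin d) ℚ_[p]}
    {T T' : Schw p d ≃ₗ[ℂ_[p]] Schw p d} (hT : IsIntertwiner hψ g T)
    (hT' : IsIntertwiner hψ g' T') : IsIntertwiner hψ (g * g') (T'.trans T) := fun h f => by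
  rw [LinearEquiv.trans_apply, LinearEquiv.trans_apply, hT, hT', Heis.act_act, Submonoid.coe_mul]

theorem IsIntertwiner.inv {hψ : IsSmoothChar ψ} {g : Matrix.symplecticGroup (Fin d) ℚ_[p]}
    {T : Schw p d ≃ₗ[ℂ_[p]] Schw p d} (hT : IsIntertwiner hψ g T) :
    IsIntertwiner hψ g⁻¹ T.symm := fun h f => by
  have h1 := hT (h.act (g⁻¹).1) (T.symm f)
  rw [Heis.act_act, ← Submonoid.coe_mul, inv_mul_cancel, Submonoid.coe_one, Heis.act_one,
    LinearEquiv.apply_symm_apply] at h1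
  rw [LinearEquiv.eq_symm_apply, h1]

theorem IsIntertwiner.one {hψ : IsSmoothChar ψ} :
    IsIntertwiner hψ (1 : Matrix.symplecticGroup (Fin d) ℚ_[p]) (LinearEquiv.refl _ _) :=
  fun h f => by rw [Submonoid.coe_one, Heis.act_one]; rfl

/-- The subgroup of the symplectic matrices that have an intertwining operator. -/
def intertwinedSubgroup (d : ℕ) (hψ : IsSmoothChar ψ) :
    Subgroup (Matrix.symplecticGroup (Fin d) ℚ_[p]) where
  carrier := {g | ∃ T, IsIntertwiner hψ g T}
  one_mem' := ⟨_, IsIntertwiner.one⟩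
  mul_mem' := fun ⟨_, hT⟩ ⟨_, hT'⟩ => ⟨_, hT.mul hT'⟩
  inv_mem' := fun ⟨_, hT⟩ => ⟨_, hT.inv⟩

/-! ### Linear algebra over a field: making a block invertible by a symmetric correction. -/

/-- A matrix `C` over a field has a generalised inverse `E`, and there is a symmetric bilinear form
that induces a nondegenerate form on the quotient by the kernel of `C`. -/
theorem exists_generalized_inverse {n K : Type*} [Fintype n] [DecidableEq n] [Field K]
    (C : Matrix n n K) : ∃ E N : Matrix n n K, C * (E * C) = C ∧ Nᵀ = N ∧ N * (E * C) = N ∧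
      ∀ x, N *ᵥ x = 0 → C *ᵥ x = 0 := by
  obtain ⟨L, L', D, hC⟩ :=
    Matrix.Pivot.exists_list_transvec_mul_diagonal_mul_list_transvec C
  set U := (L.map Matrix.TransvectionStruct.toMatrix).prod with hU
  set V := (L'.map Matrix.TransvectionStruct.toMatrix).prod with hV
  have hU1 : U⁻¹ * U = 1 := Matrix.nonsing_inv_mul _ (by
    rw [hU, Matrix.TransvectionStruct.det_toMatrix_prod]; exact isUnit_one)
  have hVdet : IsUnit V.det := by
    rw [hV, Matrix.TransvectionStruct.det_toMatrix_prod]; exact isUnit_one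
  have hV1 : V * V⁻¹ = 1 := Matrix.mul_nonsing_inv _ hVdet
  have hEC : V⁻¹ * Matrix.diagonal (fun i => (D i)⁻¹) * U⁻¹ * C =
      V⁻¹ * Matrix.diagonal (fun i => (D i)⁻¹ * D i) * V := by
    rw [hC]
    calc _ = V⁻¹ * Matrix.diagonal (fun i => (D i)⁻¹) * (U⁻¹ * U) * Matrix.diagonal D * V := by
          simp only [Matrix.mul_assoc]
      _ = V⁻¹ * (Matrix.diagonal (fun i => (D i)⁻¹) * Matrix.diagonal D) * V := by
          rw [hU1, Matrix.mul_one]; simp only [Matrix.mul_assoc]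
      _ = _ := by rw [Matrix.diagonal_mul_diagonal]
  have key : ∀ (X Y : Matrix n n K), X * V * (V⁻¹ * Y * V) = X * Y * V := fun X Y => by
    calc _ = X * (V * V⁻¹) * Y * V := by simp only [Matrix.mul_assoc]
      _ = _ := by rw [hV1, Matrix.mul_one]
  -- From `C = U * diagonal D * V`. With `0⁻¹ = 0` the diagonal matrix of `(D i)⁻¹ * D i` is the
  -- projector onto the nonzero entries, and `V` pulls it back to the form `N`.
  refine ⟨V⁻¹ * Matrix.diagonal (fun i => (D i)⁻¹) * U⁻¹,
    Vᵀ * Matrix.diagonal (fun i => (D i)⁻¹ * D i) * V, ?_, ?_, ?_, fun x hx => ?_⟩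
  · rw [hEC, hC, key, Matrix.mul_assoc U, Matrix.diagonal_mul_diagonal]
    congr 3
    ext1 i
    by_cases h : D i = 0 <;> simp [h]
  · simp [Matrix.transpose_mul, Matrix.mul_assoc]
  · rw [hEC, key, Matrix.mul_assoc Vᵀ, Matrix.diagonal_mul_diagonal]
    congr 3
    ext1 i
    by_cases h : D i = 0 <;> simp [h]
  · have hVt : IsUnit Vᵀ := by rwa [Matrix.isUnit_transpose, Matrix.isUnit_iff_isUnit_det]
    rw [Matrix.mul_assoc, ← Matrix.mulVec_mulVec] at hx
    have h1 : (Matrix.diagonal (fun i => (D i)⁻¹ * D i) * V) *ᵥ x = 0 :=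
      Matrix.mulVec_injective_of_isUnit hVt (by rw [hx, Matrix.mulVec_zero])
    have h2 : C = U * Matrix.diagonal D * (Matrix.diagonal (fun i => (D i)⁻¹ * D i) * V) := by
      rw [hC, ← Matrix.mul_assoc (U * _), Matrix.mul_assoc U _ (Matrix.diagonal _),
        Matrix.diagonal_mul_diagonal]
      congr 3
      ext1 i
      by_cases h : D i = 0 <;> simp [h]
    rw [h2, ← Matrix.mulVec_mulVec, h1, Matrix.mulVec_zero]

/-- `S` is built so that `Cᵀ * (A + S * C) = N`, with `N` nondegenerate modulo `ker C`. A vector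
killed by `A + S * C` is then killed by `C`, hence by `A`, hence is zero. -/
theorem exists_symm_isUnit_add_mul {n K : Type*} [Fintype n] [DecidableEq n] [Field K]
    {A C : Matrix n n K} (hAC : Aᵀ * C = Cᵀ * A)
    (hker : ∀ x, A *ᵥ x = 0 → C *ᵥ x = 0 → x = 0) :
    ∃ S : Matrix n n K, Sᵀ = S ∧ IsUnit (A + S * C) := by
  obtain ⟨E, N, hC, hN, hNE, hNC⟩ := exists_generalized_inverse C
  have hsym : (N - Aᵀ * C)ᵀ = N - Aᵀ * C := by
    rw [Matrix.transpose_sub, hN, Matrix.transpose_mul, Matrix.transpose_transpose, hAC]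
  have h1 : (N - Aᵀ * C) * (E * C) = N - Aᵀ * C := by
    rw [Matrix.sub_mul, hNE, Matrix.mul_assoc, hC]
  have h2 : (E * C)ᵀ * (N - Aᵀ * C) = N - Aᵀ * C := by
    have := congrArg Matrix.transpose h1
    rwa [Matrix.transpose_mul, hsym] at this
  refine ⟨Eᵀ * (N - Aᵀ * C) * E, ?_, ?_⟩
  · rw [Matrix.transpose_mul, Matrix.transpose_mul, hsym, Matrix.transpose_transpose,
      Matrix.mul_assoc]
  · rw [← Matrix.mulVec_injective_iff_isUnit, ← Matrix.coe_mulVecLin, ← LinearMap.ker_eq_bot]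
    refine Matrix.ker_mulVecLin_eq_bot_iff.2 fun x hx => ?_
    have h3 : Cᵀ * (A + Eᵀ * (N - Aᵀ * C) * E * C) = N := by
      calc _ = Cᵀ * A + (E * C)ᵀ * ((N - Aᵀ * C) * (E * C)) := by
            rw [Matrix.mul_add, Matrix.transpose_mul]; simp only [Matrix.mul_assoc]
        _ = N := by rw [h1, h2, hAC]; abel
    have hCx : C *ᵥ x = 0 := hNC x (by rw [← h3, ← Matrix.mulVec_mulVec, hx, Matrix.mulVec_zero])
    refine hker x ?_ hCx
    rwa [Matrix.add_mulVec, ← Matrix.mulVec_mulVec, hCx, Matrix.mulVec_zero, add_zero] at hx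

/-! ### Moving a symplectic matrix into the Siegel parabolic. -/

/-- The unipotent symplectic matrix attached to a symmetric matrix. -/
noncomputable def upperUnipotent {S : Matrix (Fin d) (Fin d) ℚ_[p]} (hS : Sᵀ = S) :
    Matrix.symplecticGroup (Fin d) ℚ_[p] :=
  ⟨Matrix.fromBlocks 1 S 0 1, by
    rw [SymplecticGroup.fromBlocks_mem_iff]
    simp [hS]⟩

theorem upperUnipotent_mem (hψ : IsSmoothChar ψ) {S : Matrix (Fin d) (Fin d) ℚ_[p]}
    (hS : Sᵀ = S) : upperUnipotent hS ∈ intertwinedSubgroup d hψ := by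
  obtain ⟨T, hT, -⟩ := exists_isIntertwiner_of_toBlocks₂₁_eq_zero hψ (upperUnipotent hS)
    (Matrix.toBlocks_fromBlocks₂₁ _ _ _ _)
  exact ⟨T, hT⟩

theorem coe_symJ_conj {S : Matrix (Fin d) (Fin d) ℚ_[p]} (hS : Sᵀ = S) :
    ((SymplecticGroup.symJ (Fin d) ℚ_[p])⁻¹ * upperUnipotent hS *
      SymplecticGroup.symJ (Fin d) ℚ_[p]).1 = Matrix.fromBlocks 1 0 (-S) 1 := by
  rw [Submonoid.coe_mul, Submonoid.coe_mul, SymplecticGroup.coe_inv, SymplecticGroup.coe_J,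
    upperUnipotent, Matrix.J, Matrix.fromBlocks_transpose, Matrix.fromBlocks_neg]
  simp [Matrix.fromBlocks_multiply]

/-- Every symplectic matrix has an intertwining operator. -/
theorem exists_isIntertwiner (hψ : IsSmoothChar ψ) (hψ1 : ψ ≠ 1)
    (g : Matrix.symplecticGroup (Fin d) ℚ_[p]) : ∃ T, IsIntertwiner hψ g T := by
  change g ∈ intertwinedSubgroup d hψ
  have hJ : SymplecticGroup.symJ (Fin d) ℚ_[p] ∈ intertwinedSubgroup d hψ :=
    exists_isIntertwiner_symJ hψ hψ1
  obtain ⟨M, hM⟩ := g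
  obtain ⟨A, B, C, D, rfl⟩ : ∃ A B C D, M = Matrix.fromBlocks A B C D :=
    ⟨_, _, _, _, (Matrix.fromBlocks_toBlocks M).symm⟩
  have hAC := (SymplecticGroup.fromBlocks_mem_iff.1 hM).1
  -- The first `d` columns of an invertible matrix are independent.
  have hker : ∀ x, A *ᵥ x = 0 → C *ᵥ x = 0 → x = 0 := fun x hA hC => by
    have hinj := Matrix.mulVec_injective_of_isUnit
      ((Matrix.isUnit_iff_isUnit_det _).2 (SymplecticGroup.symplectic_det hM))
    have h0 : Matrix.fromBlocks A B C D *ᵥ Sum.elim x 0 =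
        Matrix.fromBlocks A B C D *ᵥ Sum.elim 0 0 := by
      simp [Matrix.fromBlocks_mulVec, hA, hC]
    exact (Sum.elim_eq_iff.1 (hinj h0)).1
  obtain ⟨S, hS, hunit⟩ := exists_symm_isUnit_add_mul hAC hker
  obtain ⟨A', hA'⟩ : ∃ A', A' = A + S * C := ⟨_, rfl⟩
  rw [← hA', Matrix.isUnit_iff_isUnit_det] at hunit
  have hA'C : A'ᵀ * C = Cᵀ * A' := by
    rw [hA', Matrix.transpose_add, Matrix.transpose_mul, hS, Matrix.add_mul, Matrix.mul_add, hAC,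
      Matrix.mul_assoc]
  have hX : (C * A'⁻¹)ᵀ = C * A'⁻¹ := by
    have hunit' : IsUnit (A'ᵀ).det := by rwa [Matrix.det_transpose]
    rw [Matrix.transpose_mul, Matrix.transpose_nonsing_inv]
    calc (A'ᵀ)⁻¹ * Cᵀ = (A'ᵀ)⁻¹ * (Cᵀ * A' * A'⁻¹) := by
          rw [Matrix.mul_nonsing_inv_cancel_right _ _ hunit]
      _ = C * A'⁻¹ := by
          rw [← hA'C, Matrix.mul_assoc, Matrix.nonsing_inv_mul_cancel_left _ _ hunit']
  have hlow : (SymplecticGroup.symJ (Fin d) ℚ_[p])⁻¹ * upperUnipotent hX *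
      SymplecticGroup.symJ (Fin d) ℚ_[p] ∈ intertwinedSubgroup d hψ :=
    mul_mem (mul_mem (inv_mem hJ) (upperUnipotent_mem hψ hX)) hJ
  -- The upper unipotent factor makes the upper left block the invertible `A'`; the lower unipotent
  -- factor with block `-C * A'⁻¹` then clears the lower left block.
  rw [← Subgroup.mul_mem_cancel_left _ (upperUnipotent_mem hψ hS),
    ← Subgroup.mul_mem_cancel_left _ hlow]
  obtain ⟨T, hT, -⟩ := exists_isIntertwiner_of_toBlocks₂₁_eq_zero hψ
    ((SymplecticGroup.symJ (Fin d) ℚ_[p])⁻¹ * upperUnipotent hX *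
      SymplecticGroup.symJ (Fin d) ℚ_[p] * (upperUnipotent hS * ⟨_, hM⟩)) (by
    rw [Submonoid.coe_mul, coe_symJ_conj, Submonoid.coe_mul, upperUnipotent]
    simp only [Matrix.fromBlocks_multiply, Matrix.toBlocks_fromBlocks₂₁, Matrix.one_mul,
      Matrix.zero_mul, zero_add]
    rw [← hA', Matrix.neg_mul, Matrix.nonsing_inv_mul_cancel_right _ _ hunit, neg_add_cancel])
  exact ⟨T, hT⟩

/-! ## Comparison of the sup norm with its pullbacks -/

/-- When `ζ = 1` the sum is `n`, which for `n = p ^ m` is `p`-adically small; either way the sum is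
small, and this drives the inequivalence of norms. -/
theorem geom_sum_eq_zero_or_eq_one {K : Type*} [Field K] {ζ : K} {n : ℕ} (h : ζ ^ n = 1) :
    ∑ j ∈ Finset.range n, ζ ^ j = 0 ∨ ζ = 1 := by
  have h1 := geom_sum_mul ζ n
  rw [h, sub_self, mul_eq_zero, sub_eq_zero] at h1
  exact h1

theorem padicComplex_norm_prime : ‖(p : ℂ_[p])‖ = (p : ℝ)⁻¹ := by
  have h := PadicComplex.norm_extends' p (p : ℚ_[p])
  simpa using h

theorem inv_pow_lt_norm_natCast {m j : ℕ} (hj0 : j ≠ 0) (hj : j < p ^ m) :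
    (p : ℝ)⁻¹ ^ m < ‖(j : ℚ_[p])‖ := by
  by_contra! h
  have h1 := (Padic.norm_int_le_pow_iff_dvd (p := p) (j : ℤ) m).1 (by
    rwa [zpow_neg, zpow_natCast, ← inv_pow, Int.cast_natCast])
  exact absurd (Nat.le_of_dvd (Nat.pos_of_ne_zero hj0) (by exact_mod_cast h1)) (not_le.2 hj)

/-- The sum of the operators `f ↦ (x ↦ ψ(j s (v ⬝ᵥ x)) f(x))` over `j < n`. -/
noncomputable def modulationSum (hψ : IsSmoothChar ψ) (v : Fin d → ℚ_[p]) (n : ℕ) (s : ℚ_[p])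
    (f : Schw p d) : Schw p d :=
  ∑ j ∈ Finset.range n, schrodinger d hψ ⟨0, ((j : ℚ_[p]) * s) • v, 0⟩ f

theorem Schw.sum_apply {ι : Type*} (S : Finset ι) (f : ι → Schw p d) (x : Fin d → ℚ_[p]) :
    (∑ j ∈ S, f j).1 x = ∑ j ∈ S, (f j).1 x := by
  rw [← Finset.sum_apply, ← Submodule.coe_sum]

theorem modulationSum_apply (hψ : IsSmoothChar ψ) (v : Fin d → ℚ_[p]) (n : ℕ) (s : ℚ_[p])
    (f : Schw p d) (x : Fin d → ℚ_[p]) :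
    (modulationSum hψ v n s f).1 x =
      (∑ j ∈ Finset.range n, ψ (s * (v ⬝ᵥ x)) ^ j) * f.1 x := by
  rw [modulationSum, Schw.sum_apply, Finset.sum_mul]
  refine Finset.sum_congr rfl fun j _ => ?_
  rw [schrodinger_modulation, ← ψ.map_nsmul_eq_pow, smul_dotProduct, nsmul_eq_mul, smul_eq_mul,
    mul_assoc]

/-- `T⁻¹` carries modulation by a multiple of `v` to the action of `(0, v) · g`, a translation along
`v ᵥ* c` times a character. Of the coefficients only `u 0` matters, since later the other terms
vanish. -/
theorem IsIntertwiner.symm_modulationSum_apply {hψ : IsSmoothChar ψ}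
    {g : Matrix.symplecticGroup (Fin d) ℚ_[p]} {T : Schw p d ≃ₗ[ℂ_[p]] Schw p d}
    (hT : IsIntertwiner hψ g T) (v : Fin d → ℚ_[p]) (n : ℕ) (s : ℚ_[p]) (f : Schw p d)
    (y : Fin d → ℚ_[p]) :
    ∃ u : ℕ → ℂ_[p], u 0 = 1 ∧ (T.symm (modulationSum hψ v n s f)).1 y =
      ∑ j ∈ Finset.range n,
        u j * (T.symm f).1 (y + ((j : ℚ_[p]) * s) • (v ᵥ* g.1.toBlocks₂₁)) := by
  let h : ℕ → Heis p d := fun j => (⟨0, ((j : ℚ_[p]) * s) • v, 0⟩ : Heis p d).act g.1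
  refine ⟨fun j => ψ ((h j).t + 1 / 2 * ((h j).x ⬝ᵥ (h j).y) + (h j).y ⬝ᵥ y), ?_, ?_⟩
  · simp [h, Heis.act]
  · rw [modulationSum, map_sum, Schw.sum_apply]
    refine Finset.sum_congr rfl fun j _ => ?_
    have h1 : T.symm (schrodinger d hψ ⟨0, ((j : ℚ_[p]) * s) • v, 0⟩ f) =
        schrodinger d hψ (h j) (T.symm f) := by
      rw [LinearEquiv.symm_apply_eq, ← hT, LinearEquiv.apply_symm_apply]
    rw [h1, schrodinger_apply]
    congr 3
    simp [h, Heis.act, Matrix.smul_vecMul]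

/-- A nonzero function supported on the vectors `x` with `ψ(s (v ⬝ᵥ x)) = 1` whose image under
`T⁻¹` is supported on a ball determined by `s` and the lower left block of `g`. -/
theorem IsIntertwiner.exists_localized {hψ : IsSmoothChar ψ}
    {g : Matrix.symplecticGroup (Fin d) ℚ_[p]} {T : Schw p d ≃ₗ[ℂ_[p]] Schw p d}
    (hT : IsIntertwiner hψ g T) {v : Fin d → ℚ_[p]} (hv : v ᵥ* g.1.toBlocks₂₁ ≠ 0) :
    ∃ (s : ℚ_[p]) (f : Schw p d), s ≠ 0 ∧ f ≠ 0 ∧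
      (∀ x, f.1 x ≠ 0 → ψ (s * (v ⬝ᵥ x)) = 1) ∧
      ∀ y, (T.symm f).1 y ≠ 0 → ‖y‖ ≤ ‖s • (v ᵥ* g.1.toBlocks₂₁)‖ := by
  have hw : 0 < ‖v ᵥ* g.1.toBlocks₂₁‖ := norm_pos_iff.2 hv
  have hv0 : 0 < ‖v‖ := norm_pos_iff.2 (by rintro rfl; exact hv (Matrix.zero_vecMul _))
  obtain ⟨ε, hε, hψε⟩ := hψ.exists_trivial
  -- On this ball `‖v ⬝ᵥ x‖ ≤ ε`, so `ψ(v ⬝ᵥ x) = 1`.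
  let f₀ : Schw p d := Schw.ball p d (div_pos hε hv0)
  obtain ⟨R, hR, hf₀⟩ := Schw.exists_bound_support (T.symm f₀)
  have hp1 : 1 < (p : ℝ) := Nat.one_lt_cast.2 (Fact.out : p.Prime).one_lt
  have hp0 : (p : ℚ_[p]) ≠ 0 := Nat.cast_ne_zero.2 (Fact.out : p.Prime).ne_zero
  -- With `s = p ^ (-r)` the norm of `s • (v ᵥ* c)` exceeds the support radius `R` of `T⁻¹ f₀`.
  -- Summing the modulations by `j s` for `j < p ^ r` cuts `f₀` down to the points where `ψ(s (v ⬝ᵥ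
  -- x)) = 1`.
  obtain ⟨r, hr⟩ := pow_unbounded_of_one_lt (R / ‖v ᵥ* g.1.toBlocks₂₁‖) hp1
  rw [div_lt_iff₀ hw] at hr
  have hs : ‖((p : ℚ_[p]) ^ r)⁻¹‖ = (p : ℝ) ^ r := by
    rw [norm_inv, norm_pow, Padic.norm_p, inv_pow, inv_inv]
  have hpow : ∀ x, ‖x‖ ≤ ε / ‖v‖ → ψ (((p : ℚ_[p]) ^ r)⁻¹ * (v ⬝ᵥ x)) ^ (p ^ r) = 1 :=
    fun x hx => by
      rw [← ψ.map_nsmul_eq_pow, nsmul_eq_mul, Nat.cast_pow, mul_inv_cancel_left₀ (pow_ne_zero _ hp0)]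
      refine hψε _ ((norm_dotProduct_le _ _).trans ?_)
      rw [le_div_iff₀ hv0] at hx
      linarith
  refine ⟨((p : ℚ_[p]) ^ r)⁻¹, modulationSum hψ v (p ^ r) ((p : ℚ_[p]) ^ r)⁻¹ f₀,
    inv_ne_zero (pow_ne_zero _ hp0), fun h => ?_, fun x hx => ?_, fun y hy => ?_⟩
  · have h1 := modulationSum_apply hψ v (p ^ r) ((p : ℚ_[p]) ^ r)⁻¹ f₀ 0
    rw [h, Schw.ball_of_le _ (by rw [norm_zero]; positivity)] at h1
    have h2 : (0 : ℂ_[p]) = (p : ℂ_[p]) ^ r := by simpa using h1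
    exact pow_ne_zero r (Nat.cast_ne_zero.2 (Fact.out : p.Prime).ne_zero) h2.symm
  · rw [modulationSum_apply] at hx
    have hx' : ‖x‖ ≤ ε / ‖v‖ := by
      by_contra! h
      exact right_ne_zero_of_mul hx (Schw.ball_of_lt _ h)
    exact (geom_sum_eq_zero_or_eq_one (hpow x hx')).resolve_left (left_ne_zero_of_mul hx)
  · obtain ⟨u, -, hu⟩ := hT.symm_modulationSum_apply v (p ^ r) ((p : ℚ_[p]) ^ r)⁻¹ f₀ y
    rw [hu] at hy
    obtain ⟨j, -, hj⟩ := Finset.exists_ne_zero_of_sum_ne_zero hy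
    have h1 := right_ne_zero_of_mul hj
    rw [norm_smul, hs]
    have h2 : ‖y + ((j : ℚ_[p]) * ((p : ℚ_[p]) ^ r)⁻¹) • (v ᵥ* g.1.toBlocks₂₁)‖ ≤ R := by
      by_contra! h
      exact h1 (hf₀ _ h)
    by_contra! h3
    -- Since `‖j‖ ≤ 1`, no shift is longer than `s • (v ᵥ* c)`; a longer `y` keeps its norm, above
    -- `R`, after the shift.
    have h4 : ‖((j : ℚ_[p]) * ((p : ℚ_[p]) ^ r)⁻¹) • (v ᵥ* g.1.toBlocks₂₁)‖ < ‖y‖ := by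
      refine lt_of_le_of_lt ?_ h3
      rw [norm_smul, norm_mul, hs]
      have h5 : ‖(j : ℚ_[p])‖ ≤ 1 := by simpa using Padic.norm_int_le_one (p := p) (j : ℤ)
      have h6 : 0 ≤ (p : ℝ) ^ r * ‖v ᵥ* g.1.toBlocks₂₁‖ := by positivity
      nlinarith
    rw [norm_add_eq_left_of_lt h4] at h2
    linarith

/-- If the sup norm is dominated by its pullback under an intertwining operator, then the matrix
lies in the Siegel parabolic. -/
theorem IsIntertwiner.toBlocks₂₁_eq_zero {hψ : IsSmoothChar ψ}
    {g : Matrix.symplecticGroup (Fin d) ℚ_[p]} {T : Schw p d ≃ₗ[ℂ_[p]] Schw p d}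
    (hT : IsIntertwiner hψ g T)
    (hdom : (supNorm p d).Dominated ((supNorm p d).pullback T)) : g.1.toBlocks₂₁ = 0 := by
  by_contra hC
  obtain ⟨v, hv⟩ : ∃ v, v ᵥ* g.1.toBlocks₂₁ ≠ 0 := by
    by_contra! h
    refine hC (Matrix.ext fun i j => ?_)
    have := congrFun (h (Pi.single i 1)) j
    simpa using this
  obtain ⟨s, f, hs, hf, hψf, hTf⟩ := hT.exists_localized hv
  obtain ⟨D, hD, hdom⟩ := hdom
  have hp0 : (p : ℚ_[p]) ≠ 0 := Nat.cast_ne_zero.2 (Fact.out : p.Prime).ne_zero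
  have hp1 : 1 < (p : ℝ) := Nat.one_lt_cast.2 (Fact.out : p.Prime).one_lt
  obtain ⟨y, hy⟩ : ∃ y, (T.symm f).1 y ≠ 0 := by
    by_contra! h
    exact hf (T.symm.map_eq_zero_iff.1 (Subtype.ext (funext h)))
  have hsw : 0 < ‖s • (v ᵥ* g.1.toBlocks₂₁)‖ := norm_pos_iff.2 (smul_ne_zero hs hv)
  have key : ∀ m : ℕ, ‖(T.symm f).1 y‖ ≤ D * supNorm p d f * (p : ℝ)⁻¹ ^ m := by
    intro m
    -- On the support of `f` the number `ψ(p ^ (-m) s (v ⬝ᵥ x))` is a `p ^ m`-th root of unity, so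
    -- `G` is `f` times 0 or `p ^ m` at each point.
    let G := modulationSum hψ v (p ^ m) (((p : ℚ_[p]) ^ m)⁻¹ * s) f
    have hG : supNorm p d G ≤ (p : ℝ)⁻¹ ^ m * supNorm p d f := by
      refine ciSup_le fun x => ?_
      rw [modulationSum_apply, norm_mul]
      by_cases hx : f.1 x = 0
      · rw [hx, norm_zero, mul_zero]
        exact mul_nonneg (by positivity) ((supNorm p d).nonneg f)
      · refine mul_le_mul ?_ (Schw.norm_le_iSup f x) (norm_nonneg _) (by positivity)
        have hζ : ψ (((p : ℚ_[p]) ^ m)⁻¹ * s * (v ⬝ᵥ x)) ^ (p ^ m) = 1 := by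
          rw [← ψ.map_nsmul_eq_pow, nsmul_eq_mul, Nat.cast_pow, mul_assoc,
            mul_inv_cancel_left₀ (pow_ne_zero _ hp0), hψf x hx]
        rcases geom_sum_eq_zero_or_eq_one hζ with h | h
        · rw [h, norm_zero]; positivity
        · simp only [h, one_pow, Finset.sum_const, Finset.card_range, nsmul_one, Nat.cast_pow,
            norm_pow, padicComplex_norm_prime]
          exact le_rfl
    -- For `0 < j < p ^ m` one has `‖j‖ > p ^ (-m)`, so the shift by `j p ^ (-m) s • (v ᵥ* c)`
    -- leaves the ball containing the support of `T⁻¹ f`; only `j = 0` contributes.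
    have hGy : (T.symm G).1 y = (T.symm f).1 y := by
      obtain ⟨u, hu0, hu⟩ :=
        hT.symm_modulationSum_apply v (p ^ m) (((p : ℚ_[p]) ^ m)⁻¹ * s) f y
      rw [hu, Finset.sum_eq_single_of_mem 0
        (Finset.mem_range.2 (pow_pos (Fact.out : p.Prime).pos m))]
      · rw [hu0]; simp
      · intro j hj hj0
        have h1 := inv_pow_lt_norm_natCast hj0 (Finset.mem_range.1 hj)
        have h2 : ‖s • (v ᵥ* g.1.toBlocks₂₁)‖ <
            ‖((j : ℚ_[p]) * (((p : ℚ_[p]) ^ m)⁻¹ * s)) • (v ᵥ* g.1.toBlocks₂₁)‖ := by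
          rw [← mul_assoc, mul_smul, norm_smul (_ * _), norm_mul, norm_inv, norm_pow, Padic.norm_p]
          refine lt_mul_of_one_lt_left hsw ?_
          rwa [← div_eq_mul_inv, one_lt_div (inv_prime_pow_pos m)]
        have h3 := hTf y hy
        have h4 : (T.symm f).1
            (y + ((j : ℚ_[p]) * (((p : ℚ_[p]) ^ m)⁻¹ * s)) • (v ᵥ* g.1.toBlocks₂₁)) = 0 := by
          by_contra h
          have h5 := hTf _ h
          rw [add_comm, norm_add_eq_left_of_lt (h3.trans_lt h2)] at h5
          exact absurd h2 (not_lt.2 h5)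
        rw [h4, mul_zero]
    calc ‖(T.symm f).1 y‖ = ‖(T.symm G).1 y‖ := by rw [hGy]
      _ ≤ supNorm p d (T.symm G) := Schw.norm_le_iSup _ y
      _ ≤ D * supNorm p d (T (T.symm G)) := hdom _
      _ = D * supNorm p d G := by rw [LinearEquiv.apply_symm_apply]
      _ ≤ D * ((p : ℝ)⁻¹ ^ m * supNorm p d f) := mul_le_mul_of_nonneg_left hG hD.le
      _ = D * supNorm p d f * (p : ℝ)⁻¹ ^ m := by ring
  have hlim : Filter.Tendsto (fun m : ℕ => D * supNorm p d f * (p : ℝ)⁻¹ ^ m) Filter.atTop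
      (nhds 0) := by
    simpa using (tendsto_pow_atTop_nhds_zero_of_lt_one (by positivity)
      (inv_lt_one_of_one_lt₀ hp1)).const_mul (D * supNorm p d f)
  exact hy (norm_le_zero_iff.1 (ge_of_tendsto' hlim key))

/-! ## The action on homothety classes -/

theorem homothetic_of_smul {K V : Type*} [NormedField K] [AddCommGroup V] [Module K V]
    (N : UltraNorm K V) {T T' : V ≃ₗ[K] V} {c : K} (hc : c ≠ 0) (h : ∀ v, T' v = c • T v) :
    (N.pullback T').Homothetic (N.pullback T) :=
  ⟨‖c‖, norm_pos_iff.2 hc, fun v => by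
    change N (T' v) = ‖c‖ * N (T v)
    rw [h, N.smul_eq]⟩

theorem UltraNorm.Homothetic.equivalent {K V : Type*} [NormedField K] [AddCommGroup V] [Module K V]
    {N₁ N₂ : UltraNorm K V} (h : N₁.Homothetic N₂) : N₁.Equivalent N₂ := by
  have aux : ∀ {N₁ N₂ : UltraNorm K V}, N₁.Homothetic N₂ → N₁.Dominated N₂ :=
    fun ⟨c, hc, h⟩ => ⟨c, hc, fun v => (h v).le⟩
  exact ⟨aux h, aux (UltraNorm.homothetic_equivalence.symm h)⟩

/-- The explicit intertwiner preserves the sup norm, and any other one is a scalar multiple of it.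
-/
theorem IsIntertwiner.homothetic_of_toBlocks₂₁_eq_zero {hψ : IsSmoothChar ψ} (hψ1 : ψ ≠ 1)
    {g : Matrix.symplecticGroup (Fin d) ℚ_[p]} {T : Schw p d ≃ₗ[ℂ_[p]] Schw p d}
    (hT : IsIntertwiner hψ g T) (hg : g.1.toBlocks₂₁ = 0) :
    (supNorm p d).Homothetic ((supNorm p d).pullback T) := by
  obtain ⟨T', hT', h⟩ := exists_isIntertwiner_of_toBlocks₂₁_eq_zero hψ g hg
  obtain ⟨c, hc, hcT⟩ := hT.exists_smul hψ1 hT'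
  obtain ⟨e, he, heT⟩ := homothetic_of_smul (supNorm p d) hc hcT
  exact ⟨e, he, fun f => (h f).symm.trans (heT f)⟩

theorem IsIntertwiner.pullback_toClass_eq {hψ : IsSmoothChar ψ} (hψ1 : ψ ≠ 1)
    {g : Matrix.symplecticGroup (Fin d) ℚ_[p]} {T T' : Schw p d ≃ₗ[ℂ_[p]] Schw p d}
    (hT : IsIntertwiner hψ g T) (hT' : IsIntertwiner hψ g T')
    (N : InvNorm (schrodinger d hψ)) :
    (N.pullback hT').toClass = (N.pullback hT).toClass := by
  obtain ⟨c, hc, h⟩ := hT.exists_smul hψ1 hT'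
  exact Quotient.sound (s := invNormSetoid _) (homothetic_of_smul N.1 hc h)

/-- The map `[N] ↦ [N ∘ T]` on homothety classes of invariant norms. -/
noncomputable def InvNormClass.pullback {hψ : IsSmoothChar ψ} {g : Matrix.symplecticGroup (Fin d) ℚ_[p]}
    {T : Schw p d ≃ₗ[ℂ_[p]] Schw p d} (hT : IsIntertwiner hψ g T) :
    InvNormClass (schrodinger d hψ) → InvNormClass (schrodinger d hψ) :=
  Quotient.lift (s := invNormSetoid _) (fun N => (N.pullback hT).toClass) (by
    rintro N N' ⟨c, hc, h⟩
    exact Quotient.sound (s := invNormSetoid _) ⟨c, hc, fun f => h (T f)⟩)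

/-- The map `[N] ↦ [N ∘ T_g]` for a chosen intertwining operator `T_g`. -/
noncomputable def InvNormClass.act (hψ : IsSmoothChar ψ) (hψ1 : ψ ≠ 1)
    (g : Matrix.symplecticGroup (Fin d) ℚ_[p]) (x : InvNormClass (schrodinger d hψ)) :
    InvNormClass (schrodinger d hψ) :=
  InvNormClass.pullback (exists_isIntertwiner hψ hψ1 g).choose_spec x

theorem InvNormClass.act_toClass {hψ : IsSmoothChar ψ} (hψ1 : ψ ≠ 1)
    {g : Matrix.symplecticGroup (Fin d) ℚ_[p]} {T : Schw p d ≃ₗ[ℂ_[p]] Schw p d}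
    (hT : IsIntertwiner hψ g T) (N : InvNorm (schrodinger d hψ)) :
    InvNormClass.act hψ hψ1 g N.toClass = (N.pullback hT).toClass :=
  hT.pullback_toClass_eq hψ1 (exists_isIntertwiner hψ hψ1 g).choose_spec N

theorem InvNormClass.act_one (hψ : IsSmoothChar ψ) (hψ1 : ψ ≠ 1)
    (x : InvNormClass (schrodinger d hψ)) : InvNormClass.act hψ hψ1 1 x = x := by
  obtain ⟨N, rfl⟩ : ∃ N : InvNorm (schrodinger d hψ), N.toClass = x := Quotient.exists_rep x
  rw [InvNormClass.act_toClass hψ1 IsIntertwiner.one]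
  rfl

/-- `T ∘ T'` intertwines for `g * g'`, and `N ∘ (T ∘ T') = (N ∘ T) ∘ T'`; precomposition is what
makes this a right action. -/
theorem InvNormClass.act_mul (hψ : IsSmoothChar ψ) (hψ1 : ψ ≠ 1)
    (g g' : Matrix.symplecticGroup (Fin d) ℚ_[p]) (x : InvNormClass (schrodinger d hψ)) :
    InvNormClass.act hψ hψ1 (g * g') x =
      InvNormClass.act hψ hψ1 g' (InvNormClass.act hψ hψ1 g x) := by
  obtain ⟨N, rfl⟩ : ∃ N : InvNorm (schrodinger d hψ), N.toClass = x := Quotient.exists_rep x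
  obtain ⟨T, hT⟩ := exists_isIntertwiner hψ hψ1 g
  obtain ⟨T', hT'⟩ := exists_isIntertwiner hψ hψ1 g'
  rw [InvNormClass.act_toClass hψ1 (hT.mul hT'), InvNormClass.act_toClass hψ1 hT,
    InvNormClass.act_toClass hψ1 hT']
  rfl

/-- The right action of the symplectic group on homothety classes of invariant norms. -/
@[reducible]
noncomputable def invNormClassAction (d : ℕ) (hψ : IsSmoothChar ψ) (hψ1 : ψ ≠ 1) :
    MulAction (Matrix.symplecticGroup (Fin d) ℚ_[p])ᵐᵒᵖ (InvNormClass (schrodinger d hψ)) where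
  smul g x := InvNormClass.act hψ hψ1 g.unop x
  one_smul x := InvNormClass.act_one hψ hψ1 x
  mul_smul g g' x := InvNormClass.act_mul hψ hψ1 g'.unop g.unop x

/-- Identifies the stabilizer of the class of the sup norm, the input to orbit-stabilizer. -/
theorem supInvNorm_pullback_toClass_eq_iff {hψ : IsSmoothChar ψ} (hψ1 : ψ ≠ 1)
    {g : Matrix.symplecticGroup (Fin d) ℚ_[p]} {T : Schw p d ≃ₗ[ℂ_[p]] Schw p d}
    (hT : IsIntertwiner hψ g T) :
    ((supInvNorm d hψ).pullback hT).toClass = (supInvNorm d hψ).toClass ↔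
      g ∈ siegelParabolic p d := by
  constructor
  · intro h
    have h1 : (supNorm p d).Homothetic ((supNorm p d).pullback T) :=
      Quotient.exact (s := invNormSetoid _) h.symm
    exact hT.toBlocks₂₁_eq_zero h1.equivalent.1
  · intro h
    exact (Quotient.sound (s := invNormSetoid _)
      (hT.homothetic_of_toBlocks₂₁_eq_zero hψ1 h)).symm

/-- If the stabilizer of `x` for a right action is `H`, then `H g ↦ x · g` is a bijection from
`H \ G` onto the orbit of `x`. -/
theorem exists_rightCosets_equiv_orbit {G X : Type*} [Group G] [MulAction Gᵐᵒᵖ X] (H : Subgroup G)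
    (x : X) (hH : ∀ g, MulOpposite.op g • x = x ↔ g ∈ H) :
    ∃ Φ : Quotient (QuotientGroup.rightRel H) ≃ MulAction.orbit Gᵐᵒᵖ x,
      ∀ g, (Φ (Quotient.mk (QuotientGroup.rightRel H) g) : X) = MulOpposite.op g • x := by
  -- `x · a = x · b` means that `b * a⁻¹` fixes `x`, which is the relation of lying in the same
  -- right coset.
  have key : ∀ a b : G, MulOpposite.op a • x = MulOpposite.op b • x ↔
      QuotientGroup.rightRel H a b := fun a b => by
    rw [QuotientGroup.rightRel_apply, ← hH, MulOpposite.op_mul, mul_smul, MulOpposite.op_inv,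
      inv_smul_eq_iff, eq_comm]
  refine ⟨Equiv.ofBijective (Quotient.lift
    (fun g => (⟨MulOpposite.op g • x, MulAction.mem_orbit _ _⟩ : MulAction.orbit Gᵐᵒᵖ x))
    fun a b hab => Subtype.ext ((key a b).2 hab)) ⟨?_, ?_⟩, fun g => rfl⟩
  · rintro ⟨a⟩ ⟨b⟩ hab
    exact Quotient.sound ((key a b).1 (Subtype.ext_iff.1 hab))
  · rintro ⟨_, g, rfl⟩
    exact ⟨Quotient.mk _ g.unop, rfl⟩

end HeisSchw

theorem mainTheorem11 (p : ℕ) [Fact p.Prime] (d : ℕ) (hd : 1 ≤ d)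
    (ψ : AddChar ℚ_[p] ℂ_[p]) (hψ : HeisSchw.IsSmoothChar ψ) (hψ_nontrivial : ψ ≠ 1) :
    -- the three conditions are equivalent, for every intertwining operator `T` corresponding to `g`
    (∀ (g : Matrix.symplecticGroup (Fin d) ℚ_[p])
        (T : HeisSchw.Schw p d ≃ₗ[ℂ_[p]] HeisSchw.Schw p d), HeisSchw.IsIntertwiner hψ g T →
        ((HeisSchw.supNorm p d).Homothetic ((HeisSchw.supNorm p d).pullback T) ↔
          (HeisSchw.supNorm p d).Equivalent ((HeisSchw.supNorm p d).pullback T)) ∧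
        ((HeisSchw.supNorm p d).Equivalent ((HeisSchw.supNorm p d).pullback T) ↔
          g.1.toBlocks₂₁ = 0)) ∧
    -- every `g` has an intertwining operator
    (∀ g : Matrix.symplecticGroup (Fin d) ℚ_[p],
        ∃ T : HeisSchw.Schw p d ≃ₗ[ℂ_[p]] HeisSchw.Schw p d, HeisSchw.IsIntertwiner hψ g T) ∧
    -- `[N] · g = [N ∘ T_g]` is a well defined right action on homothety classes of invariant
    -- norms, and `P g ↦ [sup] · g` is a bijection from `P \ Sp` onto the orbit of `[sup]`
    (∃ _ : MulAction (Matrix.symplecticGroup (Fin d) ℚ_[p])ᵐᵒᵖ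
          (HeisSchw.InvNormClass (HeisSchw.schrodinger d hψ)),
        (∀ (g : Matrix.symplecticGroup (Fin d) ℚ_[p])
            (T : HeisSchw.Schw p d ≃ₗ[ℂ_[p]] HeisSchw.Schw p d)
            (hT : HeisSchw.IsIntertwiner hψ g T)
            (N : HeisSchw.InvNorm (HeisSchw.schrodinger d hψ)),
            MulOpposite.op g • N.toClass = (N.pullback hT).toClass) ∧
        ∃ Φ : HeisSchw.SiegelCosets p d ≃
            MulAction.orbit (Matrix.symplecticGroup (Fin d) ℚ_[p])ᵐᵒᵖ
              (HeisSchw.supInvNorm d hψ).toClass,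
          ∀ g : Matrix.symplecticGroup (Fin d) ℚ_[p],
            (Φ (HeisSchw.SiegelCosets.mk g) :
                HeisSchw.InvNormClass (HeisSchw.schrodinger d hψ)) =
              MulOpposite.op g • (HeisSchw.supInvNorm d hψ).toClass) := by
  have hpb : ∀ (g : Matrix.symplecticGroup (Fin d) ℚ_[p])
      (T : HeisSchw.Schw p d ≃ₗ[ℂ_[p]] HeisSchw.Schw p d), HeisSchw.IsIntertwiner hψ g T →
      g.1.toBlocks₂₁ = 0 → (HeisSchw.supNorm p d).Homothetic ((HeisSchw.supNorm p d).pullback T) :=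
    fun g T hT hg => hT.homothetic_of_toBlocks₂₁_eq_zero hψ_nontrivial hg
  refine ⟨fun g T hT => ⟨⟨fun h => h.equivalent, fun h => hpb g T hT (hT.toBlocks₂₁_eq_zero h.1)⟩,
    fun h => hT.toBlocks₂₁_eq_zero h.1, fun h => (hpb g T hT h).equivalent⟩,
    HeisSchw.exists_isIntertwiner hψ hψ_nontrivial, ?_⟩
  let := HeisSchw.invNormClassAction d hψ hψ_nontrivial
  refine ⟨this, fun g T hT N => HeisSchw.InvNormClass.act_toClass hψ_nontrivial hT N,
    HeisSchw.exists_rightCosets_equiv_orbit _ _ fun g => ?_⟩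
  obtain ⟨T, hT⟩ := HeisSchw.exists_isIntertwiner hψ hψ_nontrivial g
  rw [← HeisSchw.supInvNorm_pullback_toClass_eq_iff hψ_nontrivial hT,
    ← HeisSchw.InvNormClass.act_toClass hψ_nontrivial hT]
  rfl
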